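/- **Setting.** Let $N\ge 1$ and $\mathcal I=\{1,\dots,N\}$. Each agent $i\in\mathcal I$ has a non-empty closed convex set $\Omega_i\subseteq\mathbb R^{n_i}$ and a cost $J_i:\mathbb R^n\to\mathbb R$, $n=\sum_i n_i$, which is continuous and such that $J_i(\cdot,x_{-i})$ is convex and continuously differentiable on $\mathbb R^{n_i}$ for every $x_{-i}$. The pseudo-gradient $F(x)=\mathrm{col}((\nabla_{x_i}J_i(x_i,x_{-i}))_{i\in\mathcal I})$ is $\mu$-strongly monotone and $\ell_0$-Lipschitz continuous on $\mathbb R^n$ for some $\mu,\ell_0>0$. A point $x^*\in\Omega=\Omega_1\times\dots\times\Omega_N$ is a Nash equilibrium if $J_i(x_i^*,x_{-i}^*)\le J_i(y_i,x_{-i}^*)$ for all $i$ and all $y_i\in\Omega_i$. The agents communicate over a strongly connected digraph with weighted adjacency matrix $W=(w_{i,j})\in\mathbb R^{N\times N}$ ($w_{i,j}>0$ on edges, $w_{i,j}=0$ otherwise) such that $w_{i,i}>0$ for all $i$ and $W\mathbf 1_N=\mathbf 1_N$. **Notation.** The Perron–Frobenius eigenvector of $W$ is the $q\in\mathbb R^N$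 with $q_i>0$ for all $i$, $q^\top W=q^\top$ and $\mathbf 1_N^\top q=1$. Put $Q=\mathrm{diag}(q_1,\dots,q_N)$, $\bar Q=\mathrm{diag}(q_1I_{n_1},\dots,q_NI_{n_N})$, $\boldsymbol Q=Q\otimes I_n$, and $\|v\|_P=\sqrt{v^\top Pv}$. For $\boldsymbol x=\mathrm{col}((\boldsymbol x_i)_{i\in\mathcal I})\in\mathbb R^{Nn}$ with $\boldsymbol x_i=\mathrm{col}((\boldsymbol x_{i,j})_{j\in\mathcal I})\in\mathbb R^n$, $\boldsymbol x_{i,j}\in\mathbb R^{n_j}$, let $\boldsymbol F(\boldsymbol x)=\mathrm{col}((\nabla_{x_i}J_i(\boldsymbol x_{i,i},\boldsymbol x_{i,-i}))_{i\in\mathcal I})\in\mathbb R^n$. Let $\bar\sigma$ be the second largest singular value of $Q^{1/2}WQ^{-1/2}$ ($\bar\sigma=0$ if $N=1$). Let $\bar\mu,\bar\ell>0$ be constants such that, for all $x,y\in\mathbb R^n$ and all $\boldsymbol x,\boldsymbol y\in\mathbb R^{Nn}$, $$(\bar Q^{-1}F(x)-\bar Q^{-1}F(y))^\top\bar Q(x-y)\ge\bar\mu\|x-y\|_{\bar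 Q}^2,\qquad \|\bar Q^{-1}\boldsymbol F(\boldsymbol x)-\bar Q^{-1}\boldsymbol F(\boldsymbol y)\|_{\bar Q}\le\bar\ell\|\boldsymbol x-\boldsymbol y\|_{\boldsymbol Q},$$ and, for $\alpha>0$, let $\rho_\alpha=\lambda_{\max}(M_\alpha)$ with $$M_\alpha=\begin{bmatrix}1-2\alpha\bar\mu\lambda_{\min}(Q)+\alpha^2\bar\ell^2&2\alpha\bar\ell\bar\sigma\\2\alpha\bar\ell\bar\sigma&(1+2\alpha\bar\ell+\alpha^2\bar\ell^2)\bar\sigma^2\end{bmatrix}.$$ **Algorithm.** Initialize $\boldsymbol x_{i,i}^0\in\Omega_i$, $\boldsymbol x^0_{i,j}\in\mathbb R^{n_j}$ arbitrary for $j\ne i$, and $\hat q_i^0=e_i\in\mathbb R^N$ (the $i$-th canonical basis vector). For $k\ge0$ and every $i\in\mathcal I$ set $\hat q_i^{k+1}=\sum_jw_{i,j}\hat q_j^k$, $\hat{\boldsymbol x}_i^k=\sum_jw_{i,j}\boldsymbol x_j^k$, $\boldsymbol x_{i,-i}^{k+1}=\hat{\boldsymbol x}_{i,-i}^k$ and $$\boldsymbol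 x_{i,i}^{k+1}=\mathrm{proj}_{\Omega_i}\big(\hat{\boldsymbol x}_{i,i}^k-\alpha(\hat q_{i,i}^k)^{-1}\nabla_{x_i}J_i(\hat{\boldsymbol x}_i^k)\big).$$ **Theorem.** The eigenvector $q$ and the Nash equilibrium $x^*$ exist and are unique, and constants $\bar\mu,\bar\ell>0$ as above exist. For any such $\bar\mu,\bar\ell$, if $\alpha>0$ satisfies $\rho_\alpha<1$, then for any initial condition the sequence $(\boldsymbol x^k)_{k\in\mathbb N}$ converges to $\boldsymbol x^*=\mathbf 1_N\otimes x^*$, with linear rate: for any $\epsilon>0$ there exists $K>0$, independent of the initial condition, such that for all $k\in\mathbb N$ $$\|\boldsymbol x^k-\boldsymbol x^*\|_{\boldsymbol Q}\le K(\sqrt{\rho_\alpha}+\epsilon)^k\|\boldsymbol x^0-\boldsymbol x^*\|_{\boldsymbol Q}.$$ -/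

import Mathlib

open Filter Topology

noncomputable section

namespace NashSeeking

/-! ### Spaces, weighted norms, projections, eigenvalues -/

/-- The strategy space `ℝ^{n_i}` of agent `i`. -/
abbrev Strat {N : ℕ} (n : Fin N → ℕ) (i : Fin N) : Type := EuclideanSpace ℝ (Fin (n i))

/-- The space `ℝ^n = ℝ^{n_1} × ⋯ × ℝ^{n_N}` of stacked strategies, with the Euclidean norm. -/
abbrev Joint {N : ℕ} (n : Fin N → ℕ) : Type := PiLp 2 (Strat n)

/-- The space `ℝ^{Nn}` of stacked estimates: `x i : ℝ^n` is the estimate kept by agent `i`, and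
`x i j : ℝ^{n_j}` is its estimate of the strategy of agent `j` (its own strategy if `j = i`). -/
abbrev Estimates {N : ℕ} (n : Fin N → ℕ) : Type := Fin N → Joint n

/-- The stacked vector `(y, x_{-i})`: block `i` of `x` is replaced by `y`. -/
def replace {N : ℕ} {n : Fin N → ℕ} (x : Joint n) (i : Fin N) (y : Strat n i) : Joint n :=
  WithLp.toLp 2 (Function.update (fun j => x j) i y)

/-- `⟨x, y⟩_P` for the block diagonal matrix `P = diag((q_i I)_i)`. With blocks in `ℝ^{n_i}` this is
`P = Q̄ = diag((q_i I_{n_i})_i)`; with blocks in `ℝ^n` it is `P = Q ⊗ I_n`, `Q = diag((q_i)_i)`. -/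
def wInner {N : ℕ} {E : Fin N → Type*} [∀ i, NormedAddCommGroup (E i)]
    [∀ i, InnerProductSpace ℝ (E i)] (q : Fin N → ℝ) (x y : ∀ i, E i) : ℝ :=
  ∑ i, q i * inner ℝ (x i) (y i)

/-- `‖x‖_P = √⟨x, x⟩_P`. -/
def wNorm {N : ℕ} {E : Fin N → Type*} [∀ i, NormedAddCommGroup (E i)]
    [∀ i, InnerProductSpace ℝ (E i)] (q : Fin N → ℝ) (x : ∀ i, E i) : ℝ :=
  √(wInner q x x)

/-- The Euclidean projection of `v` onto `S`: a point of `S` at minimal distance from `v`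
(it exists and is unique for non-empty closed convex `S`). -/
def proj {E : Type*} [NormedAddCommGroup E] (S : Set E) (v : E) : E :=
  Classical.epsilon fun p => p ∈ S ∧ ∀ y ∈ S, ‖p - v‖ ≤ ‖y - v‖

/-- Largest eigenvalue of a real symmetric matrix. -/
def eigMax {m : ℕ} (A : Matrix (Fin m) (Fin m) ℝ) : ℝ := sSup (spectrum ℝ A)

/-- Smallest eigenvalue of a real symmetric matrix. -/
def eigMin {m : ℕ} (A : Matrix (Fin m) (Fin m) ℝ) : ℝ := sInf (spectrum ℝ A)

/-! ### The game -/

/-- A game: agent `i` minimises `J i (·, x_{-i})` over `Ω i`. -/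
structure Game {N : ℕ} (n : Fin N → ℕ) where
  /-- local decision sets -/
  Ω : ∀ i, Set (Strat n i)
  /-- cost functions -/
  J : Fin N → Joint n → ℝ

namespace Game

variable {N : ℕ} {n : Fin N → ℕ}

/-- Regularity of the local decision sets and of the costs. -/
structure Regular (G : Game n) : Prop where
  nonempty : ∀ i, (G.Ω i).Nonempty
  closed : ∀ i, IsClosed (G.Ω i)
  convex : ∀ i, Convex ℝ (G.Ω i)
  continuous : ∀ i, Continuous (G.J i)
  convexOn : ∀ (i : Fin N) (x : Joint n),
    ConvexOn ℝ Set.univ fun y : Strat n i => G.J i (replace x i y)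
  contDiff : ∀ (i : Fin N) (x : Joint n), ContDiff ℝ 1 fun y : Strat n i => G.J i (replace x i y)

/-- `x` is a Nash equilibrium. -/
def IsNash (G : Game n) (x : Joint n) : Prop :=
  (∀ i, x i ∈ G.Ω i) ∧ ∀ (i : Fin N), ∀ y ∈ G.Ω i, G.J i x ≤ G.J i (replace x i y)

/-- The partial gradient `∇_{x_i} J_i (x_i, x_{-i})`. -/
def partialGrad (G : Game n) (i : Fin N) (x : Joint n) : Strat n i :=
  gradient (fun y : Strat n i => G.J i (replace x i y)) (x i)

/-- The pseudo-gradient mapping `F`. -/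
def pseudoGrad (G : Game n) (x : Joint n) : Joint n :=
  WithLp.toLp 2 fun i => G.partialGrad i x

/-- The extended pseudo-gradient mapping: agent `i` uses its own estimate `x i`. -/
def extPseudoGrad (G : Game n) (x : Estimates n) : Joint n :=
  WithLp.toLp 2 fun i => G.partialGrad i (x i)

end Game

/-- `Q̄⁻¹ v`, where `Q̄ = diag((q_i I_{n_i})_i)`. -/
def scaleInv {N : ℕ} {n : Fin N → ℕ} (q : Fin N → ℝ) (v : Joint n) : Joint n :=
  WithLp.toLp 2 fun i => (q i)⁻¹ • v i

namespace Game

variable {N : ℕ} {n : Fin N → ℕ}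

/-- `F̄ = Q̄⁻¹ F` is `μ`-strongly monotone for the inner product weighted by `Q̄`. -/
def ScaledStronglyMonotone (G : Game n) (q : Fin N → ℝ) (μ : ℝ) : Prop :=
  ∀ x y : Joint n, μ * wNorm q (fun i => (x - y) i) ^ 2 ≤
    wInner q (fun i => (scaleInv q (G.pseudoGrad x) - scaleInv q (G.pseudoGrad y)) i)
      (fun i => (x - y) i)

/-- The extended mapping `Q̄⁻¹ 𝐅` is `ℓ`-Lipschitz from the norm weighted by `Q ⊗ I_n` to the norm
weighted by `Q̄`. -/
def ScaledExtLipschitz (G : Game n) (q : Fin N → ℝ) (ℓ : ℝ) : Prop :=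
  ∀ x y : Estimates n,
    wNorm q (fun i => (scaleInv q (G.extPseudoGrad x) - scaleInv q (G.extPseudoGrad y)) i) ≤
      ℓ * wNorm q (x - y)

end Game

/-! ### The network -/

/-- `W` is a weighted adjacency matrix of the digraph `𝒢`. -/
def IsWeightedAdjacency {N : ℕ} (𝒢 : Digraph (Fin N)) (W : Matrix (Fin N) (Fin N) ℝ) : Prop :=
  ∀ i j, (𝒢.Adj i j → 0 < W i j) ∧ (¬ 𝒢.Adj i j → W i j = 0)

/-- Every vertex can be reached from every other one along directed edges. -/
def StronglyConnected {N : ℕ} (𝒢 : Digraph (Fin N)) : Prop :=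
  ∀ i j, Relation.ReflTransGen 𝒢.Adj i j

/-- `q` is a (left, positive, normalised) Perron-Frobenius eigenvector of `W`. -/
def IsPerronFrobenius {N : ℕ} (W : Matrix (Fin N) (Fin N) ℝ) (q : Fin N → ℝ) : Prop :=
  (∀ i, 0 < q i) ∧ Matrix.vecMul q W = q ∧ ∑ i, q i = 1

/-- `σ̄`, the second largest singular value of `Q^{1/2} W Q^{-1/2}`. Mathlib lists singular values in
nonincreasing order, starting with index `0` and continued by `0`; so `σ̄ = 0` if there is only one
agent. -/
def sigmaBar {N : ℕ} (W : Matrix (Fin N) (Fin N) ℝ) (q : Fin N → ℝ) : ℝ :=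
  (Matrix.toEuclideanLin (Matrix.diagonal (fun i => √(q i)) * W *
    Matrix.diagonal (fun i => (√(q i))⁻¹))).singularValues 1

/-- The matrix `M_α`. -/
def stepMatrix {N : ℕ} (W : Matrix (Fin N) (Fin N) ℝ) (q : Fin N → ℝ) (μ ℓ α : ℝ) :
    Matrix (Fin 2) (Fin 2) ℝ :=
  !![1 - 2 * α * μ * eigMin (Matrix.diagonal q) + α ^ 2 * ℓ ^ 2, (2 * α * ℓ) * sigmaBar W q;
    (2 * α * ℓ) * sigmaBar W q, (1 + 2 * α * ℓ + α ^ 2 * ℓ ^ 2) * sigmaBar W q ^ 2]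

/-- `ρ_α = λ_max(M_α)`. -/
def rho {N : ℕ} (W : Matrix (Fin N) (Fin N) ℝ) (q : Fin N → ℝ) (μ ℓ α : ℝ) : ℝ :=
  eigMax (stepMatrix W q μ ℓ α)

/-! ### The algorithm -/

/-- One consensus step `(W ⊗ I) z`, that is `z_i ↦ ∑_j w_{ij} z_j`; as `w_{ij} = 0` unless `j` is an
in-neighbour of `i`, the sum is over the in-neighbours of `i`. -/
def mix {N : ℕ} {V : Type*} [AddCommGroup V] [Module ℝ V] (W : Matrix (Fin N) (Fin N) ℝ)
    (z : Fin N → V) : Fin N → V :=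
  fun i => ∑ j, W i j • z j

/-- The online estimates of the Perron-Frobenius eigenvector: `qHat W k i j` is the `j`-th entry of
the estimate of agent `i` at step `k`. -/
def qHat {N : ℕ} (W : Matrix (Fin N) (Fin N) ℝ) : ℕ → Fin N → (Fin N → ℝ)
  | 0 => fun i => Pi.single i 1
  | k + 1 => mix W (qHat W k)

/-- The iterates of the algorithm with step sizes `α k` and initial estimates `x₀`. -/
def iterates {N : ℕ} {n : Fin N → ℕ} (G : Game n) (W : Matrix (Fin N) (Fin N) ℝ) (α : ℕ → ℝ)
    (x₀ : Estimates n) : ℕ → Estimates n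
  | 0 => x₀
  | k + 1 => fun i =>
      replace (mix W (iterates G W α x₀ k) i) i
        (proj (G.Ω i) (mix W (iterates G W α x₀ k) i i -
          (α k * (qHat W k i i)⁻¹) • G.partialGrad i (mix W (iterates G W α x₀ k) i)))

end NashSeeking

end

/-! In the norm weighted by `q`, consensus vectors are orthogonal to the vectors of zero
`q`-weighted mean. Since `q` is a left fixed vector of `W`, mixing preserves this splitting: it
fixes the consensus part and contracts the disagreement by `sigmaBar`
(`IsPerronFrobenius.wNorm_mix_le`).

Write the error before mixing as consensus `v` plus disagreement `w`. Take a gradient step with the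
exact scaling `(q i)⁻¹`. Strong monotonicity, available only between consensus points, controls the
part along `v`; the Lipschitz bound controls everything involving the disagreement
(`le_wInner_gradShift`). The squared error after the step is then at most the quadratic form of
`stepMatrix` at `(‖v‖, ‖w‖)`, hence at most `rho` times the old one (`wNorm_sub_gradShift_le`).

The actual step uses `qHat` in place of `q`. The equilibrium is a fixed point of the projected step
for any positive step sizes, one per agent (`Regular.isNash_iff_proj`), and projections are
nonexpansive. So the wrong scaling only adds a multiple of the error whose factor vanishes, because
the powers of `W` converge to the matrix with all rows `q` (`wNorm_step_le`). A sequence with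
contraction factor `√ρ + o(1)` decays like `(√ρ + ε) ^ k` (`exists_le_mul_pow`). -/

noncomputable section

namespace NashSeeking

/-! ### Projections onto convex sets and variational inequalities -/

section Projection

variable {E : Type*} [NormedAddCommGroup E] [InnerProductSpace ℝ E] {S : Set E}

/-- Adding the two obtuse-angle inequalities gives firm nonexpansiveness, and Cauchy–Schwarz
finishes. The case `v = v'` also gives uniqueness of the projection. -/
theorem norm_sub_le_of_inner_le {p p' v v' : E} (h : inner ℝ (v - p) (p' - p) ≤ 0)
    (h' : inner ℝ (v' - p') (p - p') ≤ 0) : ‖p - p'‖ ≤ ‖v - v'‖ := by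
  have h1 : ‖p - p'‖ ^ 2 ≤ inner ℝ (v - v') (p - p') := by
    have e : inner ℝ (v - v') (p - p') - ‖p - p'‖ ^ 2 =
        -(inner ℝ (v - p) (p' - p) + inner ℝ (v' - p') (p - p')) := by
      rw [← real_inner_self_eq_norm_sq]
      simp only [inner_sub_left, inner_sub_right]
      ring
    linarith
  have h2 := real_inner_le_norm (v - v') (p - p')
  by_contra! hlt
  nlinarith [norm_nonneg (v - v')]

variable [CompleteSpace E]

theorem proj_spec (hne : S.Nonempty) (hc : IsClosed S) (hS : Convex ℝ S) (v : E) :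
    proj S v ∈ S ∧ ∀ y ∈ S, ‖proj S v - v‖ ≤ ‖y - v‖ := by
  refine Classical.epsilon_spec (p := fun p => p ∈ S ∧ ∀ y ∈ S, ‖p - v‖ ≤ ‖y - v‖) ?_
  obtain ⟨p, hp, h⟩ := exists_norm_eq_iInf_of_complete_convex hne hc.isComplete hS v
  refine ⟨p, hp, fun y hy => ?_⟩
  rw [norm_sub_rev p, norm_sub_rev y, h]
  exact ciInf_le (f := fun w : S => ‖v - w‖) ⟨0, by rintro _ ⟨w, rfl⟩; positivity⟩ ⟨y, hy⟩

theorem inner_sub_proj_le (hne : S.Nonempty) (hc : IsClosed S) (hS : Convex ℝ S) (v : E) :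
    ∀ y ∈ S, inner ℝ (v - proj S v) (y - proj S v) ≤ 0 := by
  obtain ⟨hp, h⟩ := proj_spec hne hc hS v
  refine (norm_eq_iInf_iff_real_inner_le_zero hS hp).1 ?_
  have : Nonempty S := hne.to_subtype
  refine le_antisymm (le_ciInf fun w => ?_) ?_
  · rw [norm_sub_rev, norm_sub_rev v]
    exact h w w.2
  · exact ciInf_le (f := fun w : S => ‖v - w‖) ⟨0, by rintro _ ⟨w, rfl⟩; positivity⟩ ⟨_, hp⟩

theorem norm_proj_sub_proj_le (hne : S.Nonempty) (hc : IsClosed S) (hS : Convex ℝ S) (v w : E) :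
    ‖proj S v - proj S w‖ ≤ ‖v - w‖ :=
  norm_sub_le_of_inner_le (inner_sub_proj_le hne hc hS v _ (proj_spec hne hc hS w).1)
    (inner_sub_proj_le hne hc hS w _ (proj_spec hne hc hS v).1)

theorem proj_eq_iff (hne : S.Nonempty) (hc : IsClosed S) (hS : Convex ℝ S) (v p : E) :
    proj S v = p ↔ p ∈ S ∧ ∀ y ∈ S, inner ℝ (v - p) (y - p) ≤ 0 := by
  refine ⟨?_, fun ⟨hp, h⟩ => ?_⟩
  · rintro rfl
    exact ⟨(proj_spec hne hc hS v).1, inner_sub_proj_le hne hc hS v⟩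
  · have := norm_sub_le_of_inner_le (inner_sub_proj_le hne hc hS v _ hp)
      (h _ (proj_spec hne hc hS v).1)
    rw [sub_self, norm_zero] at this
    exact sub_eq_zero.1 (norm_le_zero_iff.1 this)

/-- Variational inequality characterisation of the constrained minimisers of a convex function. -/
theorem isMinOn_iff_inner_gradient_nonneg {f : E → ℝ} (hf : ConvexOn ℝ Set.univ f)
    (hS : Convex ℝ S) {x : E} (hx : x ∈ S) (hd : DifferentiableAt ℝ f x) :
    (∀ y ∈ S, f x ≤ f y) ↔ ∀ y ∈ S, 0 ≤ inner ℝ (gradient f x) (y - x) := by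
  have hg := hd.hasGradientAt.hasFDerivAt
  refine ⟨fun h y hy => ?_, fun h y hy => ?_⟩
  · have hmin : IsLocalMinOn f S x := IsMinOn.localize (fun y hy => h y hy)
    simpa using hmin.hasFDerivWithinAt_nonneg hg.hasFDerivWithinAt
      (sub_mem_posTangentConeAt_of_segment_subset (hS.segment_subset hx hy))
  -- Restricted to the line through `x` and `y`, convexity bounds the derivative at `0` by the slope
  -- over `[0, 1]`, which is `f y - f x`.
  · have hφ : ConvexOn ℝ Set.univ fun t : ℝ => f (AffineMap.lineMap x y t) := by
      exact hf.comp_affineMap (AffineMap.lineMap x y : ℝ →ᵃ[ℝ] E)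
    have hder : HasDerivAt (fun t : ℝ => f (AffineMap.lineMap x y t))
        (inner ℝ (gradient f x) (y - x)) 0 := by
      have hl : HasDerivAt (fun t : ℝ => (AffineMap.lineMap x y t : E)) (y - x) 0 :=
        AffineMap.hasDerivAt_lineMap
      have hg' : HasFDerivAt f (InnerProductSpace.toDual ℝ E (gradient f x))
          (AffineMap.lineMap x y (0 : ℝ)) := by simpa using hg
      exact hg'.comp_hasDerivAt (0 : ℝ) hl
    have := hφ.le_slope_of_hasDerivAt (Set.mem_univ 0) (Set.mem_univ 1) one_pos hder
    simp only [slope_def_field, AffineMap.lineMap_apply_one, AffineMap.lineMap_apply_zero, sub_zero,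
      div_one] at this
    linarith [h y hy]

end Projection

/-! ### Nash equilibria as fixed points; existence and uniqueness -/

namespace Game

variable {N : ℕ} {n : Fin N → ℕ} {G : Game n}

theorem replace_self (x : Joint n) (i : Fin N) : replace x i (x i) = x := by
  ext1 j
  simp [replace]

theorem Regular.isNash_iff (hG : G.Regular) (x : Joint n) :
    G.IsNash x ↔ (∀ i, x i ∈ G.Ω i) ∧
      ∀ i, ∀ y ∈ G.Ω i, 0 ≤ inner ℝ (G.partialGrad i x) (y - x i) := by
  refine and_congr_right fun hx => forall_congr' fun i => ?_
  rw [partialGrad, ← isMinOn_iff_inner_gradient_nonneg (hG.convexOn i x) (hG.convex i) (hx i)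
    (((hG.contDiff i x).differentiable one_ne_zero) (x i))]
  simp only [replace_self]

/-- Each agent's variational inequality is unaffected by scaling its gradient by a positive number.
The freedom to choose `γ i` separately is what later accommodates the inexact step sizes. -/
theorem Regular.isNash_iff_proj (hG : G.Regular) (x : Joint n) {γ : Fin N → ℝ}
    (hγ : ∀ i, 0 < γ i) :
    G.IsNash x ↔ ∀ i, proj (G.Ω i) (x i - γ i • G.partialGrad i x) = x i := by
  rw [hG.isNash_iff, ← forall_and]
  refine forall_congr' fun i => ?_
  rw [proj_eq_iff (hG.nonempty i) (hG.closed i) (hG.convex i)]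
  refine and_congr_right fun _ => forall₂_congr fun y _ => ?_
  rw [sub_sub_cancel_left, inner_neg_left, real_inner_smul_left, neg_nonpos,
    mul_nonneg_iff_of_pos_left (hγ i)]

/-- Banach's fixed point theorem for the projected gradient map with step `γ`, whose squared
Lipschitz constant is at most `1 - 2γμ + γ²L² = 1 - μ²/L²`. -/
theorem Regular.existsUnique_isNash (hG : G.Regular) {μ ℓ : ℝ} (hμ : 0 < μ) (hℓ : 0 < ℓ)
    (hmono : ∀ x y : Joint n, μ * ‖x - y‖ ^ 2 ≤ inner ℝ (G.pseudoGrad x - G.pseudoGrad y) (x - y))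
    (hlip : ∀ x y : Joint n, ‖G.pseudoGrad x - G.pseudoGrad y‖ ≤ ℓ * ‖x - y‖) :
    ∃! x : Joint n, G.IsNash x := by
  -- Enlarging `ℓ` ensures `μ ≤ L`, which `μ ≤ ℓ` would not do when the joint space is trivial.
  set L := ℓ + μ with hL
  set γ := μ / L ^ 2 with hγdef
  have hγ : 0 < γ := by positivity
  let T : Joint n → Joint n := fun x =>
    WithLp.toLp 2 fun i => proj (G.Ω i) (x i - γ • G.partialGrad i x)
  have hfix : ∀ x, G.IsNash x ↔ T x = x := fun x => by
    rw [hG.isNash_iff_proj x (γ := fun _ => γ) (fun _ => hγ)]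
    refine ⟨fun h => ?_, fun h i => ?_⟩
    · ext1 i
      exact h i
    · exact congrArg (fun z : Joint n => z i) h
  have hT1 : ∀ x y, ‖T x - T y‖ ^ 2 ≤
      ‖(x - y) - γ • (G.pseudoGrad x - G.pseudoGrad y)‖ ^ 2 := fun x y => by
    rw [PiLp.norm_sq_eq_of_L2, PiLp.norm_sq_eq_of_L2]
    refine Finset.sum_le_sum fun i _ => pow_le_pow_left₀ (norm_nonneg _) ?_ 2
    refine (norm_proj_sub_proj_le (hG.nonempty i) (hG.closed i) (hG.convex i) _ _).trans_eq ?_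
    congr 1
    simp only [PiLp.sub_apply, PiLp.smul_apply, pseudoGrad, smul_sub]
    abel
  have hratio : 0 ≤ 1 - μ ^ 2 / L ^ 2 ∧ 1 - μ ^ 2 / L ^ 2 < 1 := by
    constructor
    · rw [sub_nonneg, div_le_one (by positivity)]
      exact pow_le_pow_left₀ hμ.le (by linarith) 2
    · have : 0 < μ ^ 2 / L ^ 2 := by positivity
      linarith
  have hT2 : ∀ x y, ‖T x - T y‖ ^ 2 ≤ (1 - μ ^ 2 / L ^ 2) * ‖x - y‖ ^ 2 := fun x y => by
    refine (hT1 x y).trans ?_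
    rw [@norm_sub_sq_real, real_inner_smul_right, norm_smul, mul_pow, Real.norm_eq_abs, sq_abs,
      real_inner_comm]
    have h1 := hmono x y
    have h2 : ‖G.pseudoGrad x - G.pseudoGrad y‖ ^ 2 ≤ L ^ 2 * ‖x - y‖ ^ 2 := by
      rw [← mul_pow]
      refine pow_le_pow_left₀ (norm_nonneg _) ((hlip x y).trans ?_) 2
      gcongr
      linarith
    have h3 : γ ^ 2 * ‖G.pseudoGrad x - G.pseudoGrad y‖ ^ 2 ≤ γ ^ 2 * (L ^ 2 * ‖x - y‖ ^ 2) := by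
      gcongr
    have h4 : γ * (μ * ‖x - y‖ ^ 2) ≤
        γ * inner ℝ (G.pseudoGrad x - G.pseudoGrad y) (x - y) := by gcongr
    have h5 : γ ^ 2 * L ^ 2 = μ ^ 2 / L ^ 2 := by
      rw [hγdef]
      field_simp
    have h6 : γ * μ = μ ^ 2 / L ^ 2 := by
      rw [hγdef]
      ring
    rw [← mul_assoc, h5] at h3
    rw [← mul_assoc, h6] at h4
    linarith
  have hcon : ContractingWith (Real.toNNReal (√(1 - μ ^ 2 / L ^ 2))) T := by
    refine ⟨?_, LipschitzWith.of_dist_le_mul fun x y => ?_⟩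
    · rw [Real.toNNReal_lt_one, Real.sqrt_lt' one_pos]
      simpa using hratio.2
    · rw [Real.coe_toNNReal _ (Real.sqrt_nonneg _), dist_eq_norm, dist_eq_norm,
        ← pow_le_pow_iff_left₀ (norm_nonneg _) (by positivity) two_ne_zero, mul_pow,
        Real.sq_sqrt hratio.1]
      exact hT2 x y
  refine ⟨hcon.fixedPoint T, (hfix _).2 hcon.fixedPoint_isFixedPt, fun y hy => ?_⟩
  exact hcon.fixedPoint_unique ((hfix y).1 hy)

end Game

/-! ### Powers of a stochastic matrix and the Perron–Frobenius vector -/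

section Stochastic

variable {N : ℕ} {W : Matrix (Fin N) (Fin N) ℝ}

theorem pow_apply_nonneg (h0 : ∀ i j, 0 ≤ W i j) (k : ℕ) (i j : Fin N) : 0 ≤ (W ^ k) i j := by
  induction k generalizing j with
  | zero => rw [pow_zero, Matrix.one_apply]; positivity
  | succ k ih =>
    rw [pow_succ, Matrix.mul_apply]
    exact Finset.sum_nonneg fun l _ => mul_nonneg (ih l) (h0 l j)

theorem sum_pow_apply (hrow : ∀ i, ∑ j, W i j = 1) (k : ℕ) (i : Fin N) :
    ∑ j, (W ^ k) i j = 1 := by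
  induction k generalizing i with
  | zero => simp [Matrix.one_apply]
  | succ k ih =>
    simp_rw [pow_succ', Matrix.mul_apply]
    rw [Finset.sum_comm]
    simp_rw [← Finset.mul_sum, ih, mul_one, hrow]

theorem mulVec_le {P : Matrix (Fin N) (Fin N) ℝ} (h0 : ∀ i j, 0 ≤ P i j)
    (hrow : ∀ i, ∑ j, P i j = 1) {v : Fin N → ℝ} {b : ℝ} (hb : ∀ j, v j ≤ b) (i : Fin N) :
    (P.mulVec v) i ≤ b := by
  calc ∑ j, P i j * v j ≤ ∑ j, P i j * b :=
        Finset.sum_le_sum fun j _ => mul_le_mul_of_nonneg_left (hb j) (h0 i j)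
    _ = b := by rw [← Finset.sum_mul, hrow, one_mul]

theorem le_mulVec {P : Matrix (Fin N) (Fin N) ℝ} (h0 : ∀ i j, 0 ≤ P i j)
    (hrow : ∀ i, ∑ j, P i j = 1) {v : Fin N → ℝ} {a : ℝ} (ha : ∀ j, a ≤ v j) (i : Fin N) :
    a ≤ (P.mulVec v) i := by
  calc a = ∑ j, P i j * a := by rw [← Finset.sum_mul, hrow, one_mul]
    _ ≤ ∑ j, P i j * v j :=
        Finset.sum_le_sum fun j _ => mul_le_mul_of_nonneg_left (ha j) (h0 i j)

/-- Dobrushin's contraction of the oscillation by a stochastic matrix with entries at least `δ`. -/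
theorem mulVec_le_sub {P : Matrix (Fin N) (Fin N) ℝ} {δ : ℝ} (h0 : ∀ i j, 0 ≤ P i j)
    (hδ : ∀ i j, δ ≤ P i j) (hrow : ∀ i, ∑ j, P i j = 1) {v : Fin N → ℝ} {b : ℝ}
    (hb : ∀ j, v j ≤ b) (i l : Fin N) : (P.mulVec v) i ≤ b - δ * (b - v l) := by
  have h1 : P i l * (b - v l) ≤ ∑ j, P i j * (b - v j) :=
    Finset.single_le_sum (f := fun j => P i j * (b - v j))
      (fun j _ => mul_nonneg (h0 i j) (sub_nonneg.2 (hb j))) (Finset.mem_univ l)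
  have h2 : ∑ j, P i j * (b - v j) = b - (P.mulVec v) i := by
    simp_rw [mul_sub, Finset.sum_sub_distrib, ← Finset.sum_mul, hrow, one_mul]
    rfl
  have h3 := mul_le_mul_of_nonneg_right (hδ i l) (sub_nonneg.2 (hb l))
  linarith

/-- The maximum entry decreases and the minimum increases, and their gap shrinks by `1 - δ` every
`m` steps. Hence the limiting gap `d ≥ 0` satisfies `d ≤ (1 - δ) d` and vanishes. -/
theorem exists_tendsto_pow_mulVec [Nonempty (Fin N)] (h0 : ∀ i j, 0 ≤ W i j)
    (hrow : ∀ i, ∑ j, W i j = 1) {m : ℕ} {δ : ℝ} (hδ0 : 0 < δ) (hδ : ∀ i j, δ ≤ (W ^ m) i j)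
    (v : Fin N → ℝ) :
    ∃ c : ℝ, ∀ i, Tendsto (fun k => ((W ^ k).mulVec v) i) atTop (𝓝 c) := by
  set u : ℕ → Fin N → ℝ := fun k => (W ^ k).mulVec v with hu
  have hadd : ∀ k l, u (k + l) = (W ^ l).mulVec (u k) := fun k l => by
    simp only [hu, Matrix.mulVec_mulVec, ← pow_add, add_comm]
  set M : ℕ → ℝ := fun k => ⨆ i, u k i with hM
  set m' : ℕ → ℝ := fun k => ⨅ i, u k i with hm'
  have hMle : ∀ k i, u k i ≤ M k := fun k i => le_ciSup (Set.finite_range _).bddAbove i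
  have hmle : ∀ k i, m' k ≤ u k i := fun k i => ciInf_le (Set.finite_range _).bddBelow i
  have hmM : ∀ k, m' k ≤ M k := fun k =>
    (hmle k (Classical.arbitrary _)).trans (hMle k _)
  have hMa : Antitone M := antitone_nat_of_succ_le fun k => ciSup_le fun i => by
    rw [hadd k 1, pow_one]
    exact mulVec_le h0 hrow (hMle k) i
  have hma : Monotone m' := monotone_nat_of_le_succ fun k => le_ciInf fun i => by
    rw [hadd k 1, pow_one]
    exact le_mulVec h0 hrow (hmle k) i
  have hosc : ∀ k, M (k + m) - m' (k + m) ≤ (1 - δ) * (M k - m' k) := fun k => by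
    obtain ⟨l, hl⟩ := exists_eq_ciInf_of_finite (f := u k)
    have h1 : M (k + m) ≤ M k - δ * (M k - m' k) := ciSup_le fun i => by
      rw [hadd k m]
      have := mulVec_le_sub (pow_apply_nonneg h0 m) hδ (sum_pow_apply hrow m) (hMle k) i l
      rwa [hl] at this
    have h2 := hma (Nat.le_add_right k m)
    linarith
  have hMc : Tendsto M atTop (𝓝 (⨅ k, M k)) := tendsto_atTop_ciInf hMa
    ⟨m' 0, by rintro _ ⟨k, rfl⟩; exact (hma (Nat.zero_le k)).trans (hmM k)⟩
  have hmc : Tendsto m' atTop (𝓝 (⨆ k, m' k)) := tendsto_atTop_ciSup hma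
    ⟨M 0, by rintro _ ⟨k, rfl⟩; exact (hmM k).trans (hMa (Nat.zero_le k))⟩
  have hd := hMc.sub hmc
  have hd0 : (⨅ k, M k) - (⨆ k, m' k) = 0 := by
    have h1 := le_of_tendsto_of_tendsto' (hd.comp (tendsto_add_atTop_nat m))
      (hd.const_mul (1 - δ)) hosc
    have h2 : 0 ≤ (⨅ k, M k) - (⨆ k, m' k) :=
      ge_of_tendsto' hd fun k => sub_nonneg.2 (hmM k)
    nlinarith
  refine ⟨⨅ k, M k, fun i => tendsto_of_tendsto_of_tendsto_of_le_of_le ?_ hMc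
    (fun k => hmle k i) (fun k => hMle k i)⟩
  rwa [sub_eq_zero.1 hd0]

/-- Self-loops make positivity of an entry persist in higher powers, so the largest of the path
lengths between pairs of vertices works for all pairs at once. -/
theorem exists_pow_apply_ge [Nonempty (Fin N)] {𝒢 : Digraph (Fin N)}
    (hconn : StronglyConnected 𝒢) (hadj : IsWeightedAdjacency 𝒢 W) (h0 : ∀ i j, 0 ≤ W i j)
    (hloop : ∀ i, 0 < W i i) : ∃ (m : ℕ) (δ : ℝ), 0 < δ ∧ ∀ i j, δ ≤ (W ^ m) i j := by
  have hstep : ∀ k i j l, 0 < (W ^ k) i j → 0 < W j l → 0 < (W ^ (k + 1)) i l := by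
    intro k i j l h1 h2
    rw [pow_succ, Matrix.mul_apply]
    exact (mul_pos h1 h2).trans_le <| Finset.single_le_sum
      (f := fun j => (W ^ k) i j * W j l)
      (fun j _ => mul_nonneg (pow_apply_nonneg h0 k i j) (h0 j l)) (Finset.mem_univ j)
  have hmono : ∀ k k' i j, k ≤ k' → 0 < (W ^ k) i j → 0 < (W ^ k') i j := by
    intro k k' i j hk h
    induction hk with
    | refl => exact h
    | step _ ih => exact hstep _ i j j ih (hloop j)
  have hex : ∀ p : Fin N × Fin N, ∃ k, 0 < (W ^ k) p.1 p.2 := by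
    rintro ⟨i, j⟩
    induction hconn i j with
    | refl => exact ⟨0, by simp⟩
    | tail _ h ih =>
      obtain ⟨k, hk⟩ := ih
      exact ⟨k + 1, hstep k i _ _ hk ((hadj _ _).1 h)⟩
  choose κ hκ using hex
  set m := Finset.univ.sup κ
  obtain ⟨p, hp⟩ := Finite.exists_min fun p : Fin N × Fin N => (W ^ m) p.1 p.2
  exact ⟨m, _, hmono _ m p.1 p.2 (Finset.le_sup (Finset.mem_univ p)) (hκ p),
    fun i j => hp (i, j)⟩

/-- Let `k` tend to infinity in `p Wᵏ = p`, using that `p` sums to one. -/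
theorem IsPerronFrobenius.eq_of_tendsto {p q : Fin N → ℝ} (hp : IsPerronFrobenius W p)
    (hq : ∀ i j, Tendsto (fun k => (W ^ k) i j) atTop (𝓝 (q j))) : p = q := by
  have hpow : ∀ k, Matrix.vecMul p (W ^ k) = p := fun k => by
    induction k with
    | zero => simp
    | succ k ih => rw [pow_succ, ← Matrix.vecMul_vecMul, ih, hp.2.1]
  ext j
  have h1 : Tendsto (fun k => ∑ i, p i * (W ^ k) i j) atTop (𝓝 (∑ i, p i * q j)) :=
    tendsto_finsetSum _ fun i _ => (hq i j).const_mul _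
  have h2 : ∀ k, ∑ i, p i * (W ^ k) i j = p j := fun k => congrFun (hpow k) j
  simp_rw [h2, ← Finset.sum_mul, hp.2.2, one_mul] at h1
  exact tendsto_nhds_unique tendsto_const_nhds h1

theorem exists_isPerronFrobenius [Nonempty (Fin N)] {𝒢 : Digraph (Fin N)}
    (hconn : StronglyConnected 𝒢) (hadj : IsWeightedAdjacency 𝒢 W) (h0 : ∀ i j, 0 ≤ W i j)
    (hloop : ∀ i, 0 < W i i) (hrow : ∀ i, ∑ j, W i j = 1) :
    ∃ q, IsPerronFrobenius W q ∧ ∀ i j, Tendsto (fun k => (W ^ k) i j) atTop (𝓝 (q j)) := by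
  obtain ⟨m, δ, hδ0, hδ⟩ := exists_pow_apply_ge hconn hadj h0 hloop
  have hlim : ∀ j, ∃ c, ∀ i, Tendsto (fun k => (W ^ k) i j) atTop (𝓝 c) := fun j => by
    simpa [Matrix.mulVec_single_one, Matrix.col_apply] using
      exists_tendsto_pow_mulVec h0 hrow hδ0 hδ (Pi.single j 1)
  choose q hq using hlim
  obtain ⟨i₀⟩ := ‹Nonempty (Fin N)›
  refine ⟨q, ⟨fun j => ?_, ?_, ?_⟩, fun i j => hq j i⟩
  -- Positivity survives the limit because each entry of `W ^ (k + m)` averages entries of `W ^ m`,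
  -- all at least `δ`.
  · refine hδ0.trans_le (ge_of_tendsto' ((tendsto_add_atTop_iff_nat m).2 (hq j i₀)) fun k => ?_)
    rw [pow_add]
    exact le_mulVec (v := fun l => (W ^ m) l j) (pow_apply_nonneg h0 k) (sum_pow_apply hrow k)
      (fun l => hδ l j) i₀
  · ext j
    refine tendsto_nhds_unique (f := fun k => (W ^ (k + 1)) i₀ j) ?_
      ((tendsto_add_atTop_iff_nat 1).2 (hq j i₀))
    simp_rw [pow_succ, Matrix.mul_apply]
    exact tendsto_finsetSum _ fun i _ => (hq i i₀).mul_const _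
  · have := tendsto_finsetSum Finset.univ fun j _ => hq j i₀
    simp_rw [sum_pow_apply hrow] at this
    exact tendsto_nhds_unique this tendsto_const_nhds

theorem qHat_eq_pow (k : ℕ) (i j : Fin N) : qHat W k i j = (W ^ k) i j := by
  induction k generalizing i with
  | zero => simp [qHat, Matrix.one_apply, Pi.single_apply, eq_comm]
  | succ k ih => simp [qHat, mix, pow_succ', Matrix.mul_apply, ih]

end Stochastic

/-! ### Eigenvalue and singular value bounds -/

section Eigenvalues

theorem le_eigMax {m : ℕ} {A : Matrix (Fin m) (Fin m) ℝ} {r : ℝ} (hr : r ∈ spectrum ℝ A) :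
    r ≤ eigMax A :=
  le_csSup (Matrix.finite_spectrum A).bddAbove hr

theorem eigMin_diagonal_le {m : ℕ} (q : Fin m → ℝ) (i : Fin m) :
    eigMin (Matrix.diagonal q) ≤ q i := by
  rw [eigMin, spectrum_diagonal]
  exact csInf_le (Set.finite_range q).bddBelow ⟨i, rfl⟩

/-- The larger root `r` of the characteristic polynomial satisfies `(r - a)(r - d) = b²` with both
factors nonnegative. So `r (x² + y²)` minus the form is at least the square of `√(r - a) |x| - √(r -
d) |y|`. -/
theorem quadForm_le_eigMax (a b d x y : ℝ) :
    a * x ^ 2 + 2 * b * (x * y) + d * y ^ 2 ≤ eigMax !![a, b; b, d] * (x ^ 2 + y ^ 2) := by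
  set s := √((a - d) ^ 2 + 4 * b ^ 2)
  have hs : s ^ 2 = (a - d) ^ 2 + 4 * b ^ 2 := Real.sq_sqrt (by positivity)
  have habs : |a - d| ≤ s := Real.abs_le_sqrt (by nlinarith [sq_nonneg b])
  obtain ⟨h1, h2⟩ := abs_le.1 habs
  set r := (a + d + s) / 2 with hr
  have hdet : (r - a) * (r - d) = b ^ 2 := by
    rw [hr]
    linear_combination hs / 4
  have hmem : r ∈ spectrum ℝ !![a, b; b, d] := by
    rw [spectrum.mem_iff, Matrix.isUnit_iff_isUnit_det, Matrix.det_fin_two]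
    simp only [Matrix.algebraMap_eq_diagonal, Matrix.sub_apply, Matrix.diagonal_apply,
      Pi.algebraMap_apply]
    simp
    linear_combination hdet
  refine le_trans ?_ (mul_le_mul_of_nonneg_right (le_eigMax hmem) (by positivity))
  have ha : 0 ≤ r - a := by linarith
  have hd : 0 ≤ r - d := by linarith
  have key : 2 * b * (x * y) ≤ (r - a) * x ^ 2 + (r - d) * y ^ 2 := by
    have e1 : √(r - a) ^ 2 = r - a := Real.sq_sqrt ha
    have e2 : √(r - d) ^ 2 = r - d := Real.sq_sqrt hd
    have e3 : (√(r - a) * √(r - d)) = |b| := by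
      rw [← Real.sqrt_mul ha, hdet, Real.sqrt_sq_eq_abs]
    have e4 : b * (x * y) ≤ |b| * (|x| * |y|) := by
      rw [← abs_mul, ← abs_mul]
      exact le_abs_self _
    have e5 := sq_nonneg (√(r - a) * |x| - √(r - d) * |y|)
    have e6 : (√(r - a) * |x| - √(r - d) * |y|) ^ 2 =
        (r - a) * x ^ 2 + (r - d) * y ^ 2 - 2 * (|b| * (|x| * |y|)) := by
      rw [← e3, ← sq_abs x, ← sq_abs y]
      linear_combination |x| ^ 2 * e1 + |y| ^ 2 * e2
    linarith
  linarith

/-- A contraction `T` contracts by its second largest singular value on the orthogonal complement of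
a fixed vector of `T* T`. -/
theorem norm_apply_le_singularValues_one {E : Type*} [NormedAddCommGroup E]
    [InnerProductSpace ℝ E] [FiniteDimensional ℝ E] (T : E →ₗ[ℝ] E) (hT : ∀ v, ‖T v‖ ≤ ‖v‖)
    {u v : E} (hu : u ≠ 0) (hTu : LinearMap.adjoint T (T u) = u) (huv : inner ℝ u v = 0) :
    ‖T v‖ ≤ T.singularValues 1 * ‖v‖ := by
  have hS := T.isSymmetric_adjoint_comp_self
  set e := hS.eigenvectorBasis rfl
  set l := hS.eigenvalues rfl
  have hσ : ∀ i : Fin _, T.singularValues i ^ 2 = l i := T.sq_singularValues_fin rfl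
  have hnorm : ∀ w, ‖T w‖ ^ 2 = ∑ i, l i * inner ℝ (e i) w ^ 2 := fun w => by
    have h1 : ‖T w‖ ^ 2 = inner ℝ ((LinearMap.adjoint T ∘ₗ T) w) w := by
      rw [LinearMap.comp_apply, LinearMap.adjoint_inner_left, real_inner_self_eq_norm_sq]
    rw [h1, ← e.sum_inner_mul_inner]
    refine Finset.sum_congr rfl fun i _ => ?_
    rw [hS w (e i), hS.apply_eigenvectorBasis rfl i]
    simp only [inner_smul_right, RCLike.ofReal_real_eq_id, id]
    rw [real_inner_comm w (e i)]
    ring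
  have hle : ∀ i, l i ≤ 1 := fun i => by
    have h1 : ‖T (e i)‖ ^ 2 = l i := by
      rw [hnorm, Finset.sum_eq_single i]
      · simp
      · intro j _ hj
        simp [e.inner_eq_zero hj]
      · simp
    have h2 := hT (e i)
    rw [e.norm_eq_one] at h2
    rw [← h1]
    exact pow_le_one₀ (norm_nonneg _) h2
  -- Thus `u` has components only along eigenvectors of eigenvalue `1`.
  have hlu : ∀ i, (1 - l i) * inner ℝ (e i) u = 0 := fun i => by
    have h1 : inner ℝ ((LinearMap.adjoint T ∘ₗ T) u) (e i) = l i * inner ℝ u (e i) := by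
      rw [hS u (e i), hS.apply_eigenvectorBasis rfl i]
      simp only [inner_smul_right, RCLike.ofReal_real_eq_id, id]
      rfl
    rw [LinearMap.comp_apply, hTu] at h1
    rw [real_inner_comm]
    linarith
  have hterm : ∀ i, l i * inner ℝ (e i) v ^ 2 ≤
      T.singularValues 1 ^ 2 * inner ℝ (e i) v ^ 2 := fun i => by
    have hanti : ∀ j : Fin _, (j : ℕ) ≠ 0 → l j ≤ T.singularValues 1 ^ 2 := fun j hj => by
      rw [← hσ]
      exact pow_le_pow_left₀ (T.singularValues_nonneg _)
        (T.singularValues_antitone (Nat.one_le_iff_ne_zero.2 hj)) 2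
    by_cases h1 : 1 ≤ T.singularValues 1 ^ 2
    · exact mul_le_mul_of_nonneg_right ((hle i).trans h1) (sq_nonneg _)
    -- Now the second singular value is below `1`, so every eigenvalue of nonzero index is too.
    -- Hence `u` is a multiple of the eigenvector of index `0`, and `v` has no component along it.
    by_cases hi : (i : ℕ) = 0
    · have hz : ∀ j, j ≠ i → inner ℝ (e j) u = 0 := fun j hj => by
        have hj0 : (j : ℕ) ≠ 0 := fun h => hj (Fin.ext (h.trans hi.symm))
        have := hanti j hj0
        exact (mul_eq_zero.1 (hlu j)).resolve_left (by linarith)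
      have huw : ∀ w, inner ℝ u w = inner ℝ (e i) u * inner ℝ (e i) w := fun w => by
        rw [← e.sum_inner_mul_inner, Finset.sum_eq_single i]
        · rw [real_inner_comm]
        · intro j _ hj
          rw [real_inner_comm, hz j hj, zero_mul]
        · simp
      have hne : inner ℝ (e i) u ≠ 0 := fun h => hu <| by
        have := huw u
        rwa [h, zero_mul, inner_self_eq_zero] at this
      have := huw v
      rw [huv, eq_comm, mul_eq_zero] at this
      rw [this.resolve_left hne]
      simp
    · exact mul_le_mul_of_nonneg_right (hanti i hi) (sq_nonneg _)
  rw [← pow_le_pow_iff_left₀ (norm_nonneg _)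
    (mul_nonneg (T.singularValues_nonneg 1) (norm_nonneg v)) two_ne_zero, mul_pow, hnorm,
    ← e.sum_sq_norm_inner_right v, Finset.mul_sum]
  refine Finset.sum_le_sum fun i _ => ?_
  rw [Real.norm_eq_abs, sq_abs]
  exact hterm i

end Eigenvalues

/-! ### Calculus of the weighted inner product -/

section WeightedNorm

variable {N : ℕ} {E E' : Fin N → Type*} [∀ i, NormedAddCommGroup (E i)]
  [∀ i, InnerProductSpace ℝ (E i)] [∀ i, NormedAddCommGroup (E' i)]
  [∀ i, InnerProductSpace ℝ (E' i)] {q : Fin N → ℝ}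

/-- The isometry from `∏ i, E i` with the weighted norm to the unweighted `ℓ²` sum. -/
def wScale (q : Fin N → ℝ) (x : ∀ i, E i) : PiLp 2 E := WithLp.toLp 2 fun i => √(q i) • x i

theorem wInner_eq_inner (hq : ∀ i, 0 < q i) (x y : ∀ i, E i) :
    wInner q x y = inner ℝ (wScale q x) (wScale q y) := by
  rw [wInner, PiLp.inner_apply]
  refine Finset.sum_congr rfl fun i _ => ?_
  rw [wScale, wScale, real_inner_smul_left, real_inner_smul_right, ← mul_assoc,
    Real.mul_self_sqrt (hq i).le]

theorem wNorm_eq_norm (hq : ∀ i, 0 < q i) (x : ∀ i, E i) : wNorm q x = ‖wScale q x‖ := by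
  rw [wNorm, wInner_eq_inner hq, real_inner_self_eq_norm_sq, Real.sqrt_sq (norm_nonneg _)]

theorem wNorm_nonneg (x : ∀ i, E i) : 0 ≤ wNorm q x := Real.sqrt_nonneg _

theorem wInner_self (hq : ∀ i, 0 < q i) (x : ∀ i, E i) : wInner q x x = wNorm q x ^ 2 := by
  rw [wNorm_eq_norm hq, wInner_eq_inner hq, real_inner_self_eq_norm_sq]

theorem wNorm_sq (hq : ∀ i, 0 < q i) (x : ∀ i, E i) :
    wNorm q x ^ 2 = ∑ i, q i * ‖x i‖ ^ 2 := by
  rw [← wInner_self hq, wInner]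
  simp_rw [real_inner_self_eq_norm_sq]

theorem abs_wInner_le (hq : ∀ i, 0 < q i) (x y : ∀ i, E i) :
    |wInner q x y| ≤ wNorm q x * wNorm q y := by
  rw [wInner_eq_inner hq, wNorm_eq_norm hq, wNorm_eq_norm hq]
  exact abs_real_inner_le_norm _ _

theorem wNorm_add_le (hq : ∀ i, 0 < q i) (x y : ∀ i, E i) :
    wNorm q (x + y) ≤ wNorm q x + wNorm q y := by
  rw [wNorm_eq_norm hq, wNorm_eq_norm hq, wNorm_eq_norm hq]
  refine le_trans (le_of_eq ?_) (norm_add_le _ _)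
  congr 1
  ext1 i
  simp [wScale]

theorem wInner_add_left (x y z : ∀ i, E i) :
    wInner q (x + y) z = wInner q x z + wInner q y z := by
  simp only [wInner, Pi.add_apply, inner_add_left, mul_add, Finset.sum_add_distrib]

theorem wInner_add_right (x y z : ∀ i, E i) :
    wInner q x (y + z) = wInner q x y + wInner q x z := by
  simp only [wInner, Pi.add_apply, inner_add_right, mul_add, Finset.sum_add_distrib]

theorem wInner_smul_right (x y : ∀ i, E i) (c : ℝ) :
    wInner q x (c • y) = c * wInner q x y := by
  simp only [wInner, Pi.smul_apply, real_inner_smul_right, Finset.mul_sum, mul_left_comm]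

theorem wInner_comm (x y : ∀ i, E i) : wInner q x y = wInner q y x := by
  simp only [wInner, real_inner_comm]

theorem wNorm_add_sq (hq : ∀ i, 0 < q i) (x y : ∀ i, E i) :
    wNorm q (x + y) ^ 2 = wNorm q x ^ 2 + 2 * wInner q x y + wNorm q y ^ 2 := by
  simp only [← wInner_self hq, wInner_add_left, wInner_add_right, wInner_comm y x]
  ring

theorem wNorm_le_mul_of_norm_le (hq : ∀ i, 0 < q i) {x : ∀ i, E i} {y : ∀ i, E' i} {c : ℝ}
    (hc : 0 ≤ c) (h : ∀ i, ‖x i‖ ≤ c * ‖y i‖) : wNorm q x ≤ c * wNorm q y := by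
  rw [← pow_le_pow_iff_left₀ (wNorm_nonneg _) (mul_nonneg hc (wNorm_nonneg _)) two_ne_zero,
    mul_pow, wNorm_sq hq, wNorm_sq hq, Finset.mul_sum]
  refine Finset.sum_le_sum fun i _ => ?_
  rw [mul_left_comm, ← mul_pow]
  have := hq i
  have := h i
  gcongr

theorem sqrt_mul_norm_le_wNorm (hq : ∀ i, 0 < q i) (x : ∀ i, E i) (i : Fin N) :
    √(q i) * ‖x i‖ ≤ wNorm q x := by
  rw [← pow_le_pow_iff_left₀ (by positivity) (wNorm_nonneg _) two_ne_zero, mul_pow,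
    Real.sq_sqrt (hq i).le, wNorm_sq hq]
  exact Finset.single_le_sum (f := fun i => q i * ‖x i‖ ^ 2)
    (fun j _ => mul_nonneg (hq j).le (sq_nonneg _)) (Finset.mem_univ i)

end WeightedNorm

/-! ### Contraction of the disagreement by mixing -/

section Consensus

variable {N : ℕ} {W : Matrix (Fin N) (Fin N) ℝ} {q : Fin N → ℝ}

theorem IsPerronFrobenius.le_one (hq : IsPerronFrobenius W q) (i : Fin N) : q i ≤ 1 := by
  rw [← hq.2.2]
  exact Finset.single_le_sum (fun j _ => (hq.1 j).le) (Finset.mem_univ i)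

/-- Convexity of the square along each row of `W`, averaged with weights `q`, then `qᵀ W = qᵀ`. -/
theorem IsPerronFrobenius.sum_mul_mulVec_sq_le (hq : IsPerronFrobenius W q)
    (h0 : ∀ i j, 0 ≤ W i j) (hrow : ∀ i, ∑ j, W i j = 1) (w : Fin N → ℝ) :
    ∑ i, q i * (W.mulVec w) i ^ 2 ≤ ∑ i, q i * w i ^ 2 := by
  have hJ : ∀ i, (W.mulVec w) i ^ 2 ≤ ∑ j, W i j * w j ^ 2 := fun i => by
    have := Finset.sum_sq_le_sum_mul_sum_of_sq_le_mul Finset.univ (r := fun j => W i j * w j)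
      (f := fun j => W i j) (g := fun j => W i j * w j ^ 2) (fun j _ => h0 i j)
      (fun j _ => mul_nonneg (h0 i j) (sq_nonneg _)) (fun j _ => le_of_eq (by ring))
    rwa [hrow, one_mul] at this
  calc ∑ i, q i * (W.mulVec w) i ^ 2 ≤ ∑ i, q i * ∑ j, W i j * w j ^ 2 :=
        Finset.sum_le_sum fun i _ => mul_le_mul_of_nonneg_left (hJ i) (hq.1 i).le
    _ = ∑ j, (Matrix.vecMul q W) j * w j ^ 2 := by
        simp_rw [Finset.mul_sum, ← mul_assoc]
        rw [Finset.sum_comm]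
        simp_rw [← Finset.sum_mul]
        rfl
    _ = ∑ i, q i * w i ^ 2 := by rw [hq.2.1]

/-- Scaling by `√q` turns `W` into the Euclidean contraction `A`. The vector `√q` is fixed by `A`
(unit row sums) and by its adjoint (`qᵀ W = qᵀ`), and orthogonality to it means zero weighted mean;
`norm_apply_le_singularValues_one` applies. -/
theorem IsPerronFrobenius.sum_mul_mulVec_sq_le_sigmaBar (hN : 0 < N)
    (hq : IsPerronFrobenius W q) (h0 : ∀ i j, 0 ≤ W i j) (hrow : ∀ i, ∑ j, W i j = 1)
    {w : Fin N → ℝ} (hw : ∑ i, q i * w i = 0) :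
    ∑ i, q i * (W.mulVec w) i ^ 2 ≤ sigmaBar W q ^ 2 * ∑ i, q i * w i ^ 2 := by
  set A := Matrix.diagonal (fun i => √(q i)) * W * Matrix.diagonal (fun i => (√(q i))⁻¹) with hA
  have hs : ∀ i, √(q i) ≠ 0 := fun i => (Real.sqrt_pos.2 (hq.1 i)).ne'
  have hss : ∀ i, √(q i) ^ 2 = q i := fun i => Real.sq_sqrt (hq.1 i).le
  set sc : (Fin N → ℝ) → EuclideanSpace ℝ (Fin N) :=
    fun w => WithLp.toLp 2 fun i => √(q i) * w i with hsc
  have hnsc : ∀ w, ‖sc w‖ ^ 2 = ∑ i, q i * w i ^ 2 := fun w => by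
    rw [EuclideanSpace.norm_sq_eq]
    refine Finset.sum_congr rfl fun i _ => ?_
    simp [hsc, mul_pow, hss]
  have hTsc : ∀ w, Matrix.toEuclideanLin A (sc w) = sc (W.mulVec w) := fun w => by
    ext i
    simp only [Matrix.ofLp_toLpLin, Matrix.toLin'_apply, hA, hsc, ← Matrix.mulVec_mulVec]
    rw [Matrix.mulVec_diagonal]
    congr 3
    ext j
    rw [Matrix.mulVec_diagonal, inv_mul_cancel_left₀ (hs j)]
  have hsurj : ∀ v : EuclideanSpace ℝ (Fin N), ∃ w, sc w = v := fun v =>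
    ⟨fun i => (√(q i))⁻¹ * v i, by ext i; simp [hsc, mul_inv_cancel_left₀ (hs i)]⟩
  have hcon : ∀ v, ‖Matrix.toEuclideanLin A v‖ ≤ ‖v‖ := fun v => by
    obtain ⟨w, rfl⟩ := hsurj v
    rw [← pow_le_pow_iff_left₀ (norm_nonneg _) (norm_nonneg _) two_ne_zero, hTsc, hnsc, hnsc]
    exact hq.sum_mul_mulVec_sq_le h0 hrow w
  have hone : W.mulVec (fun _ => 1) = fun _ => 1 := by
    ext i
    simp [Matrix.mulVec, dotProduct, hrow]
  have hu : sc (fun _ => 1) ≠ 0 := fun h => by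
    have := congrArg (fun v : EuclideanSpace ℝ (Fin N) => v ⟨0, hN⟩) h
    simp [hsc, hs] at this
  have hfix : LinearMap.adjoint (Matrix.toEuclideanLin A)
      (Matrix.toEuclideanLin A (sc fun _ => 1)) = sc fun _ => 1 := by
    rw [hTsc, hone, ← Matrix.toEuclideanLin_conjTranspose_eq_adjoint]
    ext i
    have hAT : A.conjTranspose = Matrix.diagonal (fun i => (√(q i))⁻¹) *
        (W.transpose * Matrix.diagonal (fun i => √(q i))) := by
      rw [hA, Matrix.conjTranspose_eq_transpose_of_trivial, Matrix.transpose_mul,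
        Matrix.transpose_mul, Matrix.diagonal_transpose, Matrix.diagonal_transpose]
    simp only [Matrix.ofLp_toLpLin, Matrix.toLin'_apply, hAT, hsc, ← Matrix.mulVec_mulVec]
    rw [Matrix.mulVec_diagonal]
    have hd : (Matrix.diagonal fun i => √(q i)).mulVec (fun i => √(q i) * 1) = q := by
      ext j
      rw [Matrix.mulVec_diagonal, mul_one, ← sq, hss]
    rw [hd, Matrix.mulVec_transpose, hq.2.1, mul_one, inv_mul_eq_div, div_eq_iff (hs i), ← sq, hss]
  have horth : inner ℝ (sc fun _ => 1) (sc w) = 0 := by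
    rw [PiLp.inner_apply, ← hw]
    refine Finset.sum_congr rfl fun i _ => ?_
    simp only [hsc, RCLike.inner_apply, conj_trivial, mul_one]
    rw [mul_right_comm, ← sq, hss]
  have := norm_apply_le_singularValues_one _ hcon hu hfix horth
  rw [hTsc, ← pow_le_pow_iff_left₀ (norm_nonneg _) (mul_nonneg
    (LinearMap.singularValues_nonneg _ _) (norm_nonneg _)) two_ne_zero, mul_pow, hnsc, hnsc] at this
  exact this

theorem sigmaBar_nonneg : 0 ≤ sigmaBar W q := LinearMap.singularValues_nonneg _ _

/-- A consensus step contracts the disagreement by `sigmaBar`. -/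
theorem IsPerronFrobenius.wNorm_mix_le {n : Fin N → ℕ} (hN : 0 < N)
    (hq : IsPerronFrobenius W q) (h0 : ∀ i j, 0 ≤ W i j) (hrow : ∀ i, ∑ j, W i j = 1)
    {x : Estimates n} (hx : ∑ i, q i • x i = 0) :
    wNorm q (mix W x) ≤ sigmaBar W q * wNorm q x := by
  -- Mixing acts on each scalar coordinate separately, so the scalar bound can be summed over
  -- coordinates.
  have hnorm : ∀ z : Estimates n,
      wNorm q z ^ 2 = ∑ j, ∑ c, ∑ i, q i * z i j c ^ 2 := fun z => by
    rw [wNorm_sq hq.1]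
    simp_rw [PiLp.norm_sq_eq_of_L2, Finset.mul_sum, Real.norm_eq_abs,
      sq_abs]
    rw [Finset.sum_comm]
    exact Finset.sum_congr rfl fun j _ => Finset.sum_comm
  rw [← pow_le_pow_iff_left₀ (wNorm_nonneg _) (mul_nonneg sigmaBar_nonneg (wNorm_nonneg _))
    two_ne_zero, mul_pow, hnorm, hnorm, Finset.mul_sum]
  refine Finset.sum_le_sum fun j _ => ?_
  rw [Finset.mul_sum]
  refine Finset.sum_le_sum fun c _ => ?_
  have h1 : ∑ i, q i * x i j c = 0 := by
    simpa using congrArg (fun v : Joint n => v j c) hx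
  have h2 := hq.sum_mul_mulVec_sq_le_sigmaBar hN h0 hrow h1
  have h3 : ∀ i, mix W x i j c = W.mulVec (fun l => x l j c) i := fun i => by
    simp [mix, Matrix.mulVec, dotProduct]
  simp_rw [h3]
  exact h2

end Consensus

/-! ### Single-block vectors and algebra of the mixing step -/

section Replace

variable {N : ℕ} {n : Fin N → ℕ}

theorem replace_same (x : Joint n) (i : Fin N) (v : Strat n i) : replace x i v i = v := by
  simp [replace]

theorem replace_of_ne (x : Joint n) {i j : Fin N} (h : j ≠ i) (v : Strat n i) :
    replace x i v j = x j := by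
  simp [replace, h]

theorem inner_replace_zero (u : Joint n) (i : Fin N) (v : Strat n i) :
    inner ℝ u (replace 0 i v) = inner ℝ (u i) v := by
  rw [PiLp.inner_apply, Finset.sum_eq_single i]
  · rw [replace_same]
  · intro j _ hj
    rw [replace_of_ne _ hj, PiLp.zero_apply, inner_zero_right]
  · simp

theorem norm_replace_zero (i : Fin N) (v : Strat n i) : ‖replace (0 : Joint n) i v‖ = ‖v‖ := by
  rw [← sq_eq_sq₀ (norm_nonneg _) (norm_nonneg _), ← real_inner_self_eq_norm_sq,
    inner_replace_zero, replace_same, real_inner_self_eq_norm_sq]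

end Replace

section Mix

variable {N : ℕ} {V : Type*} [AddCommGroup V] [Module ℝ V] {W : Matrix (Fin N) (Fin N) ℝ}

theorem mix_add (x y : Fin N → V) : mix W (x + y) = mix W x + mix W y := by
  ext i
  simp [mix, Finset.sum_add_distrib]

theorem mix_const (hrow : ∀ i, ∑ j, W i j = 1) (v : V) :
    mix W (fun _ => v) = fun _ => v := by
  ext i
  rw [mix, ← Finset.sum_smul, hrow, one_smul]

end Mix

/-! ### One-step contraction estimates -/

section Step

variable {N : ℕ} {n : Fin N → ℕ} {G : Game n} {W : Matrix (Fin N) (Fin N) ℝ} {q : Fin N → ℝ}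

theorem wNorm_const (hq : IsPerronFrobenius W q) (v : Joint n) :
    wNorm q (fun _ : Fin N => v) = ‖v‖ := by
  rw [← sq_eq_sq₀ (wNorm_nonneg _) (norm_nonneg _), wNorm_sq hq.1, ← Finset.sum_mul, hq.2.2,
    one_mul]

theorem wInner_const_left (v : Joint n) (x : Estimates n) :
    wInner q (fun _ => v) x = inner ℝ v (∑ i, q i • x i) := by
  simp only [wInner, inner_sum, real_inner_smul_right]

theorem wNorm_blocks_le_norm (hq : IsPerronFrobenius W q) (v : Joint n) :
    wNorm q (fun i => v i) ≤ ‖v‖ := by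
  rw [← pow_le_pow_iff_left₀ (wNorm_nonneg _) (norm_nonneg _) two_ne_zero, wNorm_sq hq.1,
    PiLp.norm_sq_eq_of_L2]
  exact Finset.sum_le_sum fun i _ => mul_le_of_le_one_left (sq_nonneg _) (hq.le_one i)

theorem eigMin_mul_norm_sq_le (hq : IsPerronFrobenius W q) (v : Joint n) :
    eigMin (Matrix.diagonal q) * ‖v‖ ^ 2 ≤ wNorm q (fun i => v i) ^ 2 := by
  rw [wNorm_sq hq.1, PiLp.norm_sq_eq_of_L2, Finset.mul_sum]
  exact Finset.sum_le_sum fun i _ =>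
    mul_le_mul_of_nonneg_right (eigMin_diagonal_le q i) (sq_nonneg _)

theorem wNorm_diag_le (hq : IsPerronFrobenius W q) (x : Estimates n) :
    wNorm q (fun i => x i i) ≤ wNorm q x := by
  have := wNorm_le_mul_of_norm_le hq.1 (x := fun i => x i i) (y := x) zero_le_one
    fun i => by rw [one_mul]; exact PiLp.norm_apply_le (x i) i
  rwa [one_mul] at this

/-- The scaled difference of the extended pseudo-gradients at `y` and at `z`. -/
def gradDiff (G : Game n) (q : Fin N → ℝ) (y z : Estimates n) (i : Fin N) : Strat n i :=
  (scaleInv q (G.extPseudoGrad y) - scaleInv q (G.extPseudoGrad z)) i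

theorem gradDiff_apply (y z : Estimates n) (i : Fin N) :
    gradDiff G q y z i = (q i)⁻¹ • (G.partialGrad i (y i) - G.partialGrad i (z i)) := by
  simp [gradDiff, scaleInv, Game.extPseudoGrad, smul_sub]

theorem gradDiff_add_gradDiff (x y z : Estimates n) :
    gradDiff G q x y + gradDiff G q y z = gradDiff G q x z := by
  ext1 i
  simp [gradDiff]

/-- The displacement of the estimates `y` along the scaled gradients relative to the equilibrium. -/
def gradShift (G : Game n) (q : Fin N → ℝ) (y : Estimates n) (xs : Joint n) : Estimates n :=
  fun i => replace 0 i (gradDiff G q y (fun _ => xs) i)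

theorem wInner_gradShift (u y : Estimates n) (xs : Joint n) :
    wInner q u (gradShift G q y xs) =
      wInner q (fun i => u i i) (gradDiff G q y fun _ => xs) := by
  simp only [wInner, gradShift, inner_replace_zero]

theorem wNorm_gradShift_le {ℓ : ℝ} (hL : G.ScaledExtLipschitz q ℓ) (y : Estimates n)
    (xs : Joint n) : wNorm q (gradShift G q y xs) ≤ ℓ * wNorm q (y - fun _ => xs) := by
  refine le_trans (le_of_eq ?_) (hL y fun _ => xs)
  simp only [wNorm, wInner, gradShift, real_inner_self_eq_norm_sq, norm_replace_zero]
  rfl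

/-- Splitting `x` into consensus and disagreement, relative to the equilibrium. -/
theorem exists_consensus_decomposition (hN : 0 < N) (hq : IsPerronFrobenius W q)
    (h0 : ∀ i j, 0 ≤ W i j) (hrow : ∀ i, ∑ j, W i j = 1) (x : Estimates n) (xs : Joint n) :
    ∃ (v : Joint n) (w : Estimates n), (mix W x - fun _ => xs) = (fun _ => v) + mix W w ∧
      wNorm q (mix W w) ≤ sigmaBar W q * wNorm q w ∧
      wNorm q (x - fun _ => xs) ^ 2 = ‖v‖ ^ 2 + wNorm q w ^ 2 ∧
      wNorm q (mix W x - fun _ => xs) ^ 2 = ‖v‖ ^ 2 + wNorm q (mix W w) ^ 2 := by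
  set xb : Joint n := ∑ i, q i • x i with hxb
  set w : Estimates n := x + fun _ => -xb with hw
  have hw0 : ∑ i, q i • w i = 0 := by
    simp only [hw, Pi.add_apply, smul_add, Finset.sum_add_distrib, ← Finset.sum_smul, hq.2.2,
      one_smul, ← hxb, add_neg_cancel]
  -- Mixing preserves the weighted mean, so the Pythagorean identity holds both before and after it.
  have hmw0 : ∑ i, q i • mix W w i = 0 := by
    simp only [mix, Finset.smul_sum, smul_smul]
    rw [Finset.sum_comm, ← hw0]
    refine Finset.sum_congr rfl fun j _ => ?_
    rw [← Finset.sum_smul]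
    exact congrArg (· • w j) (congrFun hq.2.1 j)
  have hx : (x - fun _ => xs) = (fun _ => xb - xs) + w := by
    ext1 i
    simp only [hw, Pi.add_apply, Pi.sub_apply]
    abel
  have hy : (mix W x - fun _ => xs) = (fun _ => xb - xs) + mix W w := by
    rw [hw, mix_add, mix_const hrow]
    ext1 i
    simp only [Pi.add_apply, Pi.sub_apply]
    abel
  refine ⟨xb - xs, w, hy, hq.wNorm_mix_le hN h0 hrow hw0, ?_, ?_⟩
  · rw [hx, wNorm_add_sq hq.1, wInner_const_left, hw0, wNorm_const hq, inner_zero_right]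
    ring
  · rw [hy, wNorm_add_sq hq.1, wInner_const_left, hmw0, wNorm_const hq, inner_zero_right]
    ring

/-- Passing through the consensus point `xb` between `y` and the equilibrium splits the product into
four. The pairing of `v` with the gradient change from `xs` to `xb` is bounded by strong
monotonicity, the other three by Cauchy–Schwarz and the Lipschitz constant. `eigMin` enters because
monotonicity is measured with `Q̄`, whereas a consensus vector has norm `‖v‖`. -/
theorem le_wInner_gradShift (hq : IsPerronFrobenius W q) {μ ℓ : ℝ} (hμ : 0 < μ)
    (hM : G.ScaledStronglyMonotone q μ) (hL : G.ScaledExtLipschitz q ℓ) {y w : Estimates n}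
    {v xs : Joint n} (hy : (y - fun _ => xs) = (fun _ => v) + w) :
    μ * eigMin (Matrix.diagonal q) * ‖v‖ ^ 2 - 2 * ℓ * (‖v‖ * wNorm q w) - ℓ * wNorm q w ^ 2 ≤
      wInner q (y - fun _ => xs) (gradShift G q y xs) := by
  set xb : Estimates n := fun _ => v + xs with hxb
  have hv : (xb - fun _ => xs) = fun _ => v := by
    ext1 i
    simp [hxb]
  have hyw : y - xb = w := by
    ext1 i
    have := congrFun hy i
    simp only [Pi.sub_apply, Pi.add_apply, hxb] at this ⊢
    rw [add_comm v xs, ← sub_sub, this, add_sub_cancel_left]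
  have h1 : wNorm q (gradDiff G q y xb) ≤ ℓ * wNorm q w := by
    have := hL y xb
    rwa [hyw] at this
  have h2 : wNorm q (gradDiff G q xb fun _ => xs) ≤ ℓ * ‖v‖ := by
    have := hL xb fun _ => xs
    rwa [hv, wNorm_const hq] at this
  have h3 : μ * eigMin (Matrix.diagonal q) * ‖v‖ ^ 2 ≤
      wInner q (fun i => v i) (gradDiff G q xb fun _ => xs) := by
    have h := hM (v + xs) xs
    rw [add_sub_cancel_right, wInner_comm] at h
    rw [mul_assoc]
    exact (mul_le_mul_of_nonneg_left (eigMin_mul_norm_sq_le hq v) hμ.le).trans h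
  have hvn := wNorm_blocks_le_norm hq v
  have hwn := wNorm_diag_le hq w
  have c1 := (abs_le.1 (abs_wInner_le hq.1 (fun i => v i) (gradDiff G q y xb))).1
  have c2 := (abs_le.1 (abs_wInner_le hq.1 (fun i => w i i) (gradDiff G q y xb))).1
  have c3 := (abs_le.1 (abs_wInner_le hq.1 (fun i => w i i) (gradDiff G q xb fun _ => xs))).1
  have d1 := mul_le_mul hvn h1 (wNorm_nonneg _) (norm_nonneg _)
  have d2 := mul_le_mul hwn h1 (wNorm_nonneg _) (wNorm_nonneg _)
  have d3 := mul_le_mul hwn h2 (wNorm_nonneg _) (wNorm_nonneg _)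
  have hsplit : wInner q (y - fun _ => xs) (gradShift G q y xs) =
      wInner q (fun i => v i) (gradDiff G q y xb) +
      wInner q (fun i => v i) (gradDiff G q xb fun _ => xs) +
      (wInner q (fun i => w i i) (gradDiff G q y xb) +
      wInner q (fun i => w i i) (gradDiff G q xb fun _ => xs)) := by
    rw [wInner_gradShift, hy, ← wInner_add_right, ← wInner_add_right, ← wInner_add_left,
      gradDiff_add_gradDiff]
    rfl
  rw [hsplit]
  linarith

theorem wNorm_neg_smul_sq (hq : IsPerronFrobenius W q) (a : ℝ) (x : Estimates n) :
    wNorm q ((-a) • x) ^ 2 = a ^ 2 * wNorm q x ^ 2 := by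
  simp only [wNorm_sq hq.1, Finset.mul_sum, Pi.smul_apply, norm_smul, mul_pow, norm_neg,
    Real.norm_eq_abs, sq_abs, mul_left_comm]

theorem rho_nonneg {μ ℓ α : ℝ} (hℓ : 0 < ℓ) (hα : 0 < α) : 0 ≤ rho W q μ ℓ α := by
  have := quadForm_le_eigMax (1 - 2 * α * μ * eigMin (Matrix.diagonal q) + α ^ 2 * ℓ ^ 2)
    ((2 * α * ℓ) * sigmaBar W q) ((1 + 2 * α * ℓ + α ^ 2 * ℓ ^ 2) * sigmaBar W q ^ 2) 0 1
  have hnn : 0 ≤ (1 + 2 * α * ℓ + α ^ 2 * ℓ ^ 2) * sigmaBar W q ^ 2 := by positivity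
  rw [rho, stepMatrix]
  linarith

/-- The contraction estimate for one step with the exact Perron-Frobenius eigenvector. -/
theorem wNorm_sub_gradShift_le (hN : 0 < N) (hq : IsPerronFrobenius W q)
    (h0 : ∀ i j, 0 ≤ W i j) (hrow : ∀ i, ∑ j, W i j = 1) {μ ℓ α : ℝ} (hμ : 0 < μ) (hℓ : 0 < ℓ)
    (hα : 0 < α) (hM : G.ScaledStronglyMonotone q μ) (hL : G.ScaledExtLipschitz q ℓ)
    (x : Estimates n) (xs : Joint n) :
    wNorm q ((mix W x - fun _ => xs) + (-α) • gradShift G q (mix W x) xs) ≤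
      √(rho W q μ ℓ α) * wNorm q (x - fun _ => xs) := by
  obtain ⟨v, w, hy, hσ, hx2, hy2⟩ := exists_consensus_decomposition hN hq h0 hrow x xs
  rw [← pow_le_pow_iff_left₀ (wNorm_nonneg _)
    (mul_nonneg (Real.sqrt_nonneg _) (wNorm_nonneg _)) two_ne_zero, mul_pow,
    Real.sq_sqrt (rho_nonneg hℓ hα), wNorm_add_sq hq.1, wInner_smul_right, wNorm_neg_smul_sq hq,
    hx2]
  have h1 := le_wInner_gradShift hq hμ hM hL hy
  have h2 : wNorm q (gradShift G q (mix W x) xs) ^ 2 ≤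
      ℓ ^ 2 * (‖v‖ ^ 2 + wNorm q (mix W w) ^ 2) := by
    rw [← hy2, ← mul_pow]
    exact pow_le_pow_left₀ (wNorm_nonneg _) (wNorm_gradShift_le hL _ _) 2
  have h3 := mul_le_mul_of_nonneg_left h1 hα.le
  have h4 := mul_le_mul_of_nonneg_left h2 (sq_nonneg α)
  have h5 : wNorm q (mix W w) ^ 2 ≤ sigmaBar W q ^ 2 * wNorm q w ^ 2 := by
    rw [← mul_pow]
    exact pow_le_pow_left₀ (wNorm_nonneg _) hσ 2
  have h6 := mul_le_mul_of_nonneg_left h5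
    (show 0 ≤ 1 + 2 * α * ℓ + α ^ 2 * ℓ ^ 2 by positivity)
  have h7 := mul_le_mul_of_nonneg_left hσ (show 0 ≤ 4 * α * ℓ * ‖v‖ by positivity)
  -- The preceding bounds assemble into this form; its off-diagonal term is the cross term `4αℓ‖v‖`
  -- times the bound on the mixed disagreement.
  have h8 := quadForm_le_eigMax (1 - 2 * α * μ * eigMin (Matrix.diagonal q) + α ^ 2 * ℓ ^ 2)
    ((2 * α * ℓ) * sigmaBar W q) ((1 + 2 * α * ℓ + α ^ 2 * ℓ ^ 2) * sigmaBar W q ^ 2)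
    ‖v‖ (wNorm q w)
  rw [hy2, rho, stepMatrix]
  linarith

/-- A crude constant is enough, as it only multiplies the vanishing error in the step sizes. -/
theorem wNorm_mix_sub_le (hN : 0 < N) (hq : IsPerronFrobenius W q)
    (h0 : ∀ i j, 0 ≤ W i j) (hrow : ∀ i, ∑ j, W i j = 1) (x : Estimates n) (xs : Joint n) :
    wNorm q (mix W x - fun _ => xs) ≤ (1 + sigmaBar W q) * wNorm q (x - fun _ => xs) := by
  obtain ⟨v, w, -, hσ, hx2, hy2⟩ := exists_consensus_decomposition hN hq h0 hrow x xs
  have hs : 0 ≤ sigmaBar W q := sigmaBar_nonneg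
  rw [← pow_le_pow_iff_left₀ (wNorm_nonneg _)
    (mul_nonneg (by positivity) (wNorm_nonneg _)) two_ne_zero, mul_pow, hx2, hy2]
  have h5 : wNorm q (mix W w) ^ 2 ≤ sigmaBar W q ^ 2 * wNorm q w ^ 2 := by
    rw [← mul_pow]
    exact pow_le_pow_left₀ (wNorm_nonneg _) hσ 2
  have := mul_nonneg hs (sq_nonneg ‖v‖)
  have := mul_nonneg hs (sq_nonneg (wNorm q w))
  have := mul_nonneg (sq_nonneg (sigmaBar W q)) (sq_nonneg ‖v‖)
  nlinarith [sq_nonneg (wNorm q w)]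

/-- One projected gradient step with step sizes `α s i`, where `s i` approximates `(q i)⁻¹`. -/
theorem wNorm_step_le (hN : 0 < N) (hG : G.Regular) (hq : IsPerronFrobenius W q)
    (h0 : ∀ i j, 0 ≤ W i j) (hrow : ∀ i, ∑ j, W i j = 1) {μ ℓ α : ℝ} (hμ : 0 < μ) (hℓ : 0 < ℓ)
    (hα : 0 < α) (hM : G.ScaledStronglyMonotone q μ) (hL : G.ScaledExtLipschitz q ℓ)
    {xs : Joint n} (hxs : G.IsNash xs) (x : Estimates n) {s : Fin N → ℝ} (hs : ∀ i, 0 < s i)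
    {η : ℝ} (hη : ∀ i, |q i * s i - 1| ≤ η) :
    wNorm q ((fun i => replace (mix W x i) i (proj (G.Ω i)
      (mix W x i i - (α * s i) • G.partialGrad i (mix W x i)))) - fun _ => xs) ≤
      (√(rho W q μ ℓ α) + α * ℓ * (1 + sigmaBar W q) * η) * wNorm q (x - fun _ => xs) := by
  set y := mix W x with hy
  have hη0 : 0 ≤ η := (abs_nonneg _).trans (hη ⟨0, hN⟩)
  -- `gradShift` already contains `(q i)⁻¹`, so a step with `s i` is the exact step plus this
  -- residual, proportional to `q i * s i - 1`.
  set e : Estimates n := fun i => (-(α * (q i * s i - 1))) • gradShift G q y xs i with he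
  have hfix := (hG.isNash_iff_proj xs (γ := fun i => α * s i) fun i => mul_pos hα (hs i)).1 hxs
  have hpt := wNorm_le_mul_of_norm_le hq.1 zero_le_one (q := q)
    (x := (fun i => replace (y i) i (proj (G.Ω i)
      (y i i - (α * s i) • G.partialGrad i (y i)))) - fun _ => xs)
    (y := ((y - fun _ => xs) + (-α) • gradShift G q y xs) + e) fun i => by
      rw [one_mul, ← pow_le_pow_iff_left₀ (norm_nonneg _) (norm_nonneg _) two_ne_zero,
        PiLp.norm_sq_eq_of_L2, PiLp.norm_sq_eq_of_L2]
      refine Finset.sum_le_sum fun j _ => pow_le_pow_left₀ (norm_nonneg _) ?_ 2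
      -- On an agent's own block, write the equilibrium as a projection with the same step size and
      -- use nonexpansiveness; the other blocks agree exactly.
      rcases eq_or_ne j i with rfl | hj
      · simp only [he, Pi.sub_apply, Pi.add_apply, Pi.smul_apply, PiLp.sub_apply, PiLp.add_apply,
          PiLp.smul_apply, gradShift, replace_same, gradDiff_apply]
        nth_rewrite 1 [← hfix j]
        refine (norm_proj_sub_proj_le (hG.nonempty j) (hG.closed j) (hG.convex j) _ _).trans_eq ?_
        congr 1
        have hqj := (hq.1 j).ne'
        rw [smul_smul, smul_smul, add_assoc, ← add_smul,
          show -α * (q j)⁻¹ + -(α * (q j * s j - 1)) * (q j)⁻¹ = -(α * s j) by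
            field_simp; ring, neg_smul, smul_sub]
        abel
      · simp only [he, Pi.sub_apply, Pi.add_apply, Pi.smul_apply, PiLp.sub_apply, PiLp.add_apply,
          PiLp.smul_apply, gradShift, replace_of_ne _ hj, PiLp.zero_apply, smul_zero, add_zero,
          le_refl]
  have hen : wNorm q e ≤ (α * η) * wNorm q (gradShift G q y xs) :=
    wNorm_le_mul_of_norm_le hq.1 (mul_nonneg hα.le hη0) fun i => by
      rw [he, norm_smul, norm_neg, norm_mul, Real.norm_eq_abs, Real.norm_eq_abs, abs_of_pos hα]
      have := hη i
      gcongr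
  have h1 := wNorm_add_le hq.1 ((y - fun _ => xs) + (-α) • gradShift G q y xs) e
  have h2 := wNorm_sub_gradShift_le hN hq h0 hrow hμ hℓ hα hM hL x xs
  have h3 : wNorm q (gradShift G q y xs) ≤
      ℓ * ((1 + sigmaBar W q) * wNorm q (x - fun _ => xs)) :=
    (wNorm_gradShift_le hL y xs).trans
      (mul_le_mul_of_nonneg_left (wNorm_mix_sub_le hN hq h0 hrow x xs) hℓ.le)
  have h4 := hen.trans (mul_le_mul_of_nonneg_left h3 (mul_nonneg hα.le hη0))
  rw [one_mul] at hpt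
  linarith

end Step

/-! ### Linear rate and existence of the constants -/

section Convergence

/-- A sequence with asymptotic contraction factor `r` decays like `(r + ε) ^ k`, uniformly. -/
theorem exists_le_mul_pow {r ε : ℝ} (hr : 0 ≤ r) (hε : 0 < ε) {c : ℕ → ℝ}
    (hc : Tendsto c atTop (𝓝 0)) :
    ∃ K : ℝ, 0 < K ∧ ∀ u : ℕ → ℝ, (∀ k, 0 ≤ u k) → (∀ k, u (k + 1) ≤ (r + c k) * u k) →
      ∀ k, u k ≤ K * (r + ε) ^ k * u 0 := by
  have hrε : 0 < r + ε := by linarith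
  obtain ⟨k₀, hk₀⟩ := eventually_atTop.1 (hc.eventually (eventually_le_nhds hε))
  -- `f k` is the excess of the `k`-th factor over `r + ε`, truncated below at `1`. It equals `1`
  -- from `k₀` on, so the partial products are bounded by `P k₀`, which depends on `c` but not on
  -- `u`.
  set f : ℕ → ℝ := fun k => max 1 ((r + c k) / (r + ε)) with hf
  have hf1 : ∀ k, 1 ≤ f k := fun k => le_max_left _ _
  have hstep : ∀ k, r + c k ≤ f k * (r + ε) := fun k =>
    (div_le_iff₀ hrε).1 (le_max_right 1 ((r + c k) / (r + ε)))
  have hlate : ∀ k, k₀ ≤ k → f k = 1 := fun k hk =>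
    max_eq_left ((div_le_one hrε).2 (by linarith [hk₀ k hk]))
  set P : ℕ → ℝ := fun k => ∏ j ∈ Finset.range k, f j with hP
  have hPmono : Monotone P := monotone_nat_of_le_succ fun k => by
    rw [hP]
    simp only [Finset.prod_range_succ]
    exact le_mul_of_one_le_right
      (Finset.prod_nonneg fun j _ => zero_le_one.trans (hf1 j)) (hf1 k)
  have hPpos : ∀ k, 0 < P k := fun k => Finset.prod_pos fun j _ => zero_lt_one.trans_le (hf1 j)
  have hPle : ∀ k, P k ≤ P k₀ := fun k => by
    rcases le_total k k₀ with h | h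
    · exact hPmono h
    · refine le_of_eq ?_
      induction k, h using Nat.le_induction with
      | base => rfl
      | succ k hk ih =>
        rw [← ih, hP]
        simp only [Finset.prod_range_succ, hlate k hk, mul_one]
  refine ⟨P k₀, hPpos k₀, fun u hu0 hu k => ?_⟩
  have hind : ∀ k, u k ≤ P k * (r + ε) ^ k * u 0 := fun k => by
    induction k with
    | zero => simp [hP]
    | succ k ih =>
      calc u (k + 1) ≤ (r + c k) * u k := hu k
        _ ≤ (f k * (r + ε)) * (P k * (r + ε) ^ k * u 0) :=
            mul_le_mul (hstep k) ih (hu0 k) (mul_nonneg (zero_le_one.trans (hf1 k)) hrε.le)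
        _ = P (k + 1) * (r + ε) ^ (k + 1) * u 0 := by
            rw [hP]
            simp only [Finset.prod_range_succ]
            ring
  refine (hind k).trans ?_
  have := hPle k
  have := hu0 0
  gcongr

variable {N : ℕ} {n : Fin N → ℕ} {G : Game n} {W : Matrix (Fin N) (Fin N) ℝ} {q : Fin N → ℝ}

/-- Makes the step sizes `α * (qHat W k i i)⁻¹` positive at every iteration. -/
theorem pow_apply_self_pos (h0 : ∀ i j, 0 ≤ W i j) (hloop : ∀ i, 0 < W i i) (k : ℕ) (i : Fin N) :
    0 < (W ^ k) i i := by
  induction k with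
  | zero => simp
  | succ k ih =>
    rw [pow_succ, Matrix.mul_apply]
    exact (mul_pos ih (hloop i)).trans_le <| Finset.single_le_sum
      (f := fun j => (W ^ k) i j * W j i)
      (fun j _ => mul_nonneg (pow_apply_nonneg h0 k i j) (h0 j i)) (Finset.mem_univ i)

theorem exists_wNorm_iterates_le (hN : 0 < N) (hG : G.Regular) (hq : IsPerronFrobenius W q)
    (h0 : ∀ i j, 0 ≤ W i j) (hloop : ∀ i, 0 < W i i) (hrow : ∀ i, ∑ j, W i j = 1)
    (hlim : ∀ i j, Tendsto (fun k => (W ^ k) i j) atTop (𝓝 (q j)))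
    {μ ℓ α : ℝ} (hμ : 0 < μ) (hℓ : 0 < ℓ) (hα : 0 < α) (hM : G.ScaledStronglyMonotone q μ)
    (hL : G.ScaledExtLipschitz q ℓ) {xs : Joint n} (hxs : G.IsNash xs) {ε : ℝ} (hε : 0 < ε) :
    ∃ K : ℝ, 0 < K ∧ ∀ (x₀ : Estimates n) (k : ℕ),
      wNorm q (iterates G W (fun _ => α) x₀ k - fun _ => xs) ≤
        K * (√(rho W q μ ℓ α) + ε) ^ k * wNorm q (x₀ - fun _ => xs) := by
  -- The step-size error depends on `W` and `q` alone, which makes `K` uniform in the initial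
  -- estimates.
  set η : ℕ → ℝ := fun k => ∑ i, |q i * (qHat W k i i)⁻¹ - 1| with hη
  have hη0 : Tendsto η atTop (𝓝 0) := by
    have : Tendsto η atTop (𝓝 (∑ i, |q i * (q i)⁻¹ - 1|)) := by
      refine tendsto_finsetSum _ fun i _ => ?_
      simp_rw [qHat_eq_pow]
      exact ((((hlim i i).inv₀ (hq.1 i).ne').const_mul _).sub_const 1).abs
    simpa [mul_inv_cancel₀ (hq.1 _).ne'] using this
  obtain ⟨K, hK, h⟩ := exists_le_mul_pow (Real.sqrt_nonneg (rho W q μ ℓ α)) hε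
    (c := fun k => α * ℓ * (1 + sigmaBar W q) * η k)
    (by simpa using hη0.const_mul (α * ℓ * (1 + sigmaBar W q)))
  refine ⟨K, hK, fun x₀ => h (fun k => wNorm q (iterates G W (fun _ => α) x₀ k - fun _ => xs))
    (fun k => wNorm_nonneg _) fun k => ?_⟩
  refine wNorm_step_le hN hG hq h0 hrow hμ hℓ hα hM hL hxs (iterates G W (fun _ => α) x₀ k)
    (s := fun i => (qHat W k i i)⁻¹) (fun i => ?_) fun i => ?_
  · rw [qHat_eq_pow]
    exact inv_pos.2 (pow_apply_self_pos h0 hloop k i)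
  · exact Finset.single_le_sum (f := fun i => |q i * (qHat W k i i)⁻¹ - 1|)
      (fun i _ => abs_nonneg _) (Finset.mem_univ i)

theorem tendsto_of_wNorm_sub (hq : ∀ i, 0 < q i) {x : ℕ → Estimates n} {xs : Estimates n}
    (h : Tendsto (fun k => wNorm q (x k - xs)) atTop (𝓝 0)) : Tendsto x atTop (𝓝 xs) := by
  refine tendsto_pi_nhds.2 fun i => tendsto_iff_norm_sub_tendsto_zero.2 ?_
  have hs := Real.sqrt_pos.2 (hq i)
  refine squeeze_zero (fun k => norm_nonneg _) (fun k => ?_)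
    (by simpa using h.const_mul (√(q i))⁻¹)
  rw [inv_mul_eq_div, le_div_iff₀' hs]
  exact sqrt_mul_norm_le_wNorm hq (x k - xs) i

/-- The weights `q i` and `(q i)⁻¹` cancel in the inner product, and `q i ≤ 1` lets the same `μ`
serve. -/
theorem scaledStronglyMonotone_of_stronglyMonotone (hq : IsPerronFrobenius W q) {μ : ℝ}
    (hμ : 0 < μ) (hmono : ∀ x y : Joint n,
      μ * ‖x - y‖ ^ 2 ≤ inner ℝ (G.pseudoGrad x - G.pseudoGrad y) (x - y)) :
    G.ScaledStronglyMonotone q μ := fun x y => by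
  have h1 : wNorm q (fun i => (x - y) i) ^ 2 ≤ ‖x - y‖ ^ 2 :=
    pow_le_pow_left₀ (wNorm_nonneg _) (wNorm_blocks_le_norm hq (x - y)) 2
  refine (mul_le_mul_of_nonneg_left h1 hμ.le).trans ((hmono x y).trans_eq ?_)
  rw [PiLp.inner_apply, wInner]
  refine Finset.sum_congr rfl fun i _ => ?_
  have hqi := (hq.1 i).ne'
  simp only [scaleInv, PiLp.sub_apply, ← smul_sub]
  rw [real_inner_smul_left, mul_inv_cancel_left₀ hqi]

/-- Block `i` of the extended mapping is block `i` of the pseudo-gradient at agent `i`'s own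
estimate; the scaling costs at most `1 / min q`. -/
theorem exists_scaledExtLipschitz (hN : 0 < N) (hq : IsPerronFrobenius W q) {ℓ : ℝ} (hℓ : 0 < ℓ)
    (hlip : ∀ x y : Joint n, ‖G.pseudoGrad x - G.pseudoGrad y‖ ≤ ℓ * ‖x - y‖) :
    ∃ ℓb : ℝ, 0 < ℓb ∧ G.ScaledExtLipschitz q ℓb := by
  have : Nonempty (Fin N) := ⟨⟨0, hN⟩⟩
  obtain ⟨i₀, hi₀⟩ := Finite.exists_min q
  have hpos := hq.1 i₀
  refine ⟨(q i₀)⁻¹ * ℓ, by positivity, fun x y =>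
    wNorm_le_mul_of_norm_le (x := gradDiff G q x y) hq.1 (by positivity) fun i => ?_⟩
  rw [gradDiff_apply, norm_smul, norm_inv, Real.norm_of_nonneg (hq.1 i).le, mul_assoc]
  refine mul_le_mul (inv_anti₀ hpos (hi₀ i)) ?_ (norm_nonneg _) (inv_nonneg.2 hpos.le)
  exact (PiLp.norm_apply_le (G.pseudoGrad (x i) - G.pseudoGrad (y i)) i).trans (hlip _ _)

end Convergence

end NashSeeking

end

theorem theorem2 {N : ℕ} (hN : 0 < N) (n : Fin N → ℕ) (G : NashSeeking.Game n)
    (hreg : G.Regular)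
    (hmono : ∃ μ : ℝ, 0 < μ ∧ ∀ x y : NashSeeking.Joint n,
      μ * ‖x - y‖ ^ 2 ≤ inner ℝ (G.pseudoGrad x - G.pseudoGrad y) (x - y))
    (hlip : ∃ ℓ₀ : ℝ, 0 < ℓ₀ ∧ ∀ x y : NashSeeking.Joint n,
      ‖G.pseudoGrad x - G.pseudoGrad y‖ ≤ ℓ₀ * ‖x - y‖)
    (𝒢 : Digraph (Fin N)) (hconn : NashSeeking.StronglyConnected 𝒢)
    (W : Matrix (Fin N) (Fin N) ℝ) (hadj : NashSeeking.IsWeightedAdjacency 𝒢 W)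
    (hloop : ∀ i, 0 < W i i) (hrow : ∀ i, ∑ j, W i j = 1) :
    -- the objects that the convergence claim refers to are well defined
    (∃! q : Fin N → ℝ, NashSeeking.IsPerronFrobenius W q) ∧
    (∃! x : NashSeeking.Joint n, G.IsNash x) ∧
    ∀ (q : Fin N → ℝ), NashSeeking.IsPerronFrobenius W q →
    ∀ (xs : NashSeeking.Joint n), G.IsNash xs →
      (∃ μb ℓb : ℝ, 0 < μb ∧ 0 < ℓb ∧
        G.ScaledStronglyMonotone q μb ∧ G.ScaledExtLipschitz q ℓb) ∧
      -- convergence with linear rate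
      ∀ μb ℓb : ℝ, 0 < μb → 0 < ℓb →
      G.ScaledStronglyMonotone q μb → G.ScaledExtLipschitz q ℓb →
      ∀ α : ℝ, 0 < α → NashSeeking.rho W q μb ℓb α < 1 →
        (∀ x₀ : NashSeeking.Estimates n, (∀ i, x₀ i i ∈ G.Ω i) →
          Tendsto (NashSeeking.iterates G W (fun _ => α) x₀) atTop (𝓝 fun _ => xs)) ∧
        ∀ ε : ℝ, 0 < ε → ∃ K : ℝ, 0 < K ∧
          ∀ x₀ : NashSeeking.Estimates n, (∀ i, x₀ i i ∈ G.Ω i) → ∀ k : ℕ,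
            NashSeeking.wNorm q (NashSeeking.iterates G W (fun _ => α) x₀ k - fun _ => xs) ≤
              K * (√(NashSeeking.rho W q μb ℓb α) + ε) ^ k *
                NashSeeking.wNorm q (x₀ - fun _ => xs) := by
  have : Nonempty (Fin N) := ⟨⟨0, hN⟩⟩
  obtain ⟨μ, hμ, hmono⟩ := hmono
  obtain ⟨ℓ₀, hℓ₀, hlip⟩ := hlip
  have h0 : ∀ i j, 0 ≤ W i j := fun i j => by
    by_cases h : 𝒢.Adj i j
    · exact ((hadj i j).1 h).le
    · exact ((hadj i j).2 h).ge
  obtain ⟨q₀, hq₀, hlim⟩ := NashSeeking.exists_isPerronFrobenius hconn hadj h0 hloop hrow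
  refine ⟨⟨q₀, hq₀, fun p hp => hp.eq_of_tendsto hlim⟩,
    hreg.existsUnique_isNash hμ hℓ₀ hmono hlip, fun q hq xs hxs => ⟨?_, ?_⟩⟩
  · obtain ⟨ℓb, hℓb, hL⟩ := NashSeeking.exists_scaledExtLipschitz hN hq hℓ₀ hlip
    exact ⟨μ, ℓb, hμ, hℓb,
      NashSeeking.scaledStronglyMonotone_of_stronglyMonotone hq hμ hmono, hL⟩
  · intro μb ℓb hμb hℓb hM hL α hα hρ
    -- Uniqueness identifies the given `q` with the limit of the powers of `W`.
    obtain rfl := hq.eq_of_tendsto hlim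
    have hrate := fun (ε : ℝ) (hε : 0 < ε) => NashSeeking.exists_wNorm_iterates_le hN hreg hq h0
      hloop hrow hlim hμb hℓb hα hM hL hxs hε
    refine ⟨fun x₀ _ => NashSeeking.tendsto_of_wNorm_sub hq.1 ?_, fun ε hε => ?_⟩
    · have hr1 : √(NashSeeking.rho W q μb ℓb α) < 1 := by
        rw [Real.sqrt_lt' one_pos, one_pow]
        exact hρ
      -- Half the gap to `1` keeps the rate below `1`.
      obtain ⟨K, -, hK⟩ := hrate ((1 - √(NashSeeking.rho W q μb ℓb α)) / 2) (by linarith)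
      have hpow := tendsto_pow_atTop_nhds_zero_of_lt_one
        (r := √(NashSeeking.rho W q μb ℓb α) + (1 - √(NashSeeking.rho W q μb ℓb α)) / 2)
        (by linarith [Real.sqrt_nonneg (NashSeeking.rho W q μb ℓb α)]) (by linarith)
      exact squeeze_zero (fun k => NashSeeking.wNorm_nonneg _) (hK x₀)
        (by simpa using (hpow.const_mul K).mul_const (NashSeeking.wNorm q (x₀ - fun _ => xs)))
    · obtain ⟨K, hK0, hK⟩ := hrate ε hε
      exact ⟨K, hK0, fun x₀ _ => hK x₀⟩
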